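/- \textbf{Setting.} Let $V=\{1,\dots,n\}$ and consider $m$ constraints $\sum_{S\subseteq V} w_{S,k}\prod_{j\in S}x_j\le c_k$ ($1\le k\le m$) in binary variables $x_1,\dots,x_n$, with integers $w_{S,k}, c_k$ and $w_{\emptyset,k}\le 0$ (a positive constant is moved into $c_k$). Put $P_k=\sum_{S:\,w_{S,k}<0}|w_{S,k}|$, and $y_{S,k}=\prod_{j\in S}x_j$ if $w_{S,k}\ge 0$, $y_{S,k}=1-\prod_{j\in S}x_j$ otherwise, so that the $k$-th constraint reads $\sum_S |w_{S,k}|\,y_{S,k}\le c_k+P_k$. Given a partial assignment $(x_1,\dots,x_t)$, $y_{S,k}$ is \emph{closed} if all $x_j$, $j\in S$, are assigned or some $x_j$, $j\in S$, is assigned $0$. Its remaining potentials are $\tilde c_k=c_k+P_k-\sum_{S:\,y_{S,k}\text{ closed}}|w_{S,k}|\,y_{S,k}$, and it is \emph{potentially satisfiable} if $\tilde c_k\ge 0$ for all $k$. The Hilbert space consists of $n$ variable qubits and $m$ registers of $\kappa$ qubits holding two's complement integers; assume that $c_k$, $-P_k$ and $c_k+P_k$ lie in $[-2^{\kappa-1},2^{\kappa-1}-1]$.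 Let $m\ge 1$ and $n\kappa\ge 2$. Let $$Q^+_{k,t}=\sum_{\max S=t,\ w_{S,k}\ge 0}|w_{S,k}|\prod_{j\in S\setminus\{t\}}x_j,\qquad Q^-_{k,t}=\sum_{t\in S,\ w_{S,k}<0}|w_{S,k}|\prod_{j\in S,\ j<t}x_j,$$ and let $b^\pm_t$ be the truth value of "$Q^\pm_{k,t}\le r_k$ for all $k$", where $r_k$ is the content of the $k$-th register. The oracle $U_t$ applies to qubit $t$ the rotation $R_y(\theta_t)$ if $b_t^+\wedge b_t^-$, $X$ if $b_t^+\wedge\neg b_t^-$, and the identity otherwise; then it subtracts (modulo $2^\kappa$) $Q^+_{k,t}$ from the $k$-th register for every $k$ if $x_t=1$, and $Q^-_{k,t}$ if $x_t=0$. The angles $\theta_t$ are arbitrary with $\sin(\theta_t/2)\ne 0\ne\cos(\theta_t/2)$. Let $|\psi_0\rangle=|0\rangle^{n}|c_1+P_1\rangle\cdots|c_m+P_m\rangle$ and $|\psi_t\rangle=U_t\cdots U_1|\psi_0\rangle$. A partial assignment $(x_1,\dots,x_t)$ is \emph{generated} after $t$ steps if $|\psi_t\rangle$ has a non-zero amplitude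 at a basis state whose variable qubits are $x_1,\dots,x_t,0,\dots,0$. \textbf{Theorem.} (1) (Correctness.) Every basis state with non-zero amplitude in $|\psi_t\rangle$ has the form $|x_1\cdots x_t0\cdots0\rangle|\tilde c_1\rangle\cdots|\tilde c_m\rangle$ with the remaining potentials of $(x_1,\dots,x_t)$. Every potentially satisfiable $(x_1,\dots,x_t)$ is generated after $t$ steps. A complete assignment is potentially satisfiable if and only if it is feasible; in particular $|\psi_n\rangle$ contains every feasible solution. (2) (Infeasible branches.) If $(x_1,\dots,x_t)$, $t<n$, is generated after $t$ steps, then its successor $(x_1,\dots,x_t,b)$ is generated after $t+1$ steps if and only if that successor is potentially satisfiable, or $b=0$ and neither successor is potentially satisfiable; nothing else is generated after $t+1$ steps. Hence a generated assignment that is not potentially satisfiable arises from a potentially satisfiable one only if neither of the latter's two successors is potentially satisfiable. (3) (Cost.) There is an absolute constant $A$, and for every polynomial $p$ there is a polynomial $p'$, such that for every instance as above with at most $p(n)$ non-zero coefficients in each constraint, the following holds. With some number $a$ of ancilla qubits, there are quantum circuits $\mathcal C_1,\dots,\mathcal C_n$ (layers of elementary gates on disjoint qubits: arbitrary single-qubit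 unitaries, controlled $R_y$, CNOT, Toffoli) such that $\mathcal C_t$ maps $|\psi\rangle|0\rangle^{a}$ to $(U_t|\psi\rangle)|0\rangle^{a}$ for every state $|\psi\rangle$; the concatenated circuit $\mathcal C_n\cdots\mathcal C_1$ thus maps $|\psi_0\rangle|0\rangle^a$ to $|\psi_n\rangle|0\rangle^a$, has depth (number of layers) at most $p'(n)\,m\,(\log_2 n+\log_2\kappa)$, and the total number of qubits satisfies $n+m\kappa+a\le A\,(n+m\kappa)$. -/

import Mathlib

/-! ## Systems of sum constraints and partial assignments -/

/-- The data of `m` constraints `∑_{S ⊆ V} w_{S,k} ∏_{j ∈ S} x_j ≤ c_k` with integer coefficients in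
`n` binary variables, indexed by `Fin n`. -/
structure SumConstraints (n m : ℕ) where
  w : Finset (Fin n) → Fin m → ℤ
  c : Fin m → ℤ

namespace SumConstraints

variable {n m : ℕ} (I : SumConstraints n m)

/-- The product `∏_{j ∈ S} x_j ∈ {0,1}`. -/
def prodVar (x : Fin n → Bool) (S : Finset (Fin n)) : ℤ := ∏ j ∈ S, (x j).toInt

/-- The complete assignment `x` satisfies all the constraints. -/
def Feasible (x : Fin n → Bool) : Prop :=
  ∀ k, ∑ S : Finset (Fin n), I.w S k * prodVar x S ≤ I.c k

/-- The shift `P_k`, the sum of `|w_{S,k}|` over the negative coefficients. -/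
def shift (k : Fin m) : ℤ := ∑ S : Finset (Fin n) with I.w S k < 0, |I.w S k|

/-- The variable `y_{S,k}` of the shifted constraint `∑_S |w_{S,k}| y_{S,k} ≤ c_k + P_k`. -/
def yVar (x : Fin n → Bool) (S : Finset (Fin n)) (k : Fin m) : ℤ :=
  if 0 ≤ I.w S k then prodVar x S else 1 - prodVar x S

/-- With the first `t` variables assigned as in `x`, the product over `S` is closed: all of its
variables are assigned, or one of them is assigned `0`. The entries of `x` from position `t` on
play no role. -/
def Closed (t : ℕ) (x : Fin n → Bool) (S : Finset (Fin n)) : Prop :=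
  (∀ j ∈ S, j.val < t) ∨ ∃ j ∈ S, j.val < t ∧ x j = false

instance (t : ℕ) (x : Fin n → Bool) : DecidablePred (Closed t x) :=
  fun _ => inferInstanceAs (Decidable (_ ∨ _))

/-- The remaining potential `c_k + P_k - ∑_{S : y_{S,k} closed} |w_{S,k}| y_{S,k}` of the partial
assignment `(x_0, …, x_{t-1})`. -/
def remaining (t : ℕ) (x : Fin n → Bool) (k : Fin m) : ℤ :=
  I.c k + I.shift k - ∑ S : Finset (Fin n) with Closed t x S, |I.w S k| * I.yVar x S k

/-- The partial assignment `(x_0, …, x_{t-1})` is potentially satisfiable: each shifted constraint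
holds when the variables `y_{S,k}` that are not closed are set to `0`. -/
def PotentiallySatisfiable (t : ℕ) (x : Fin n → Bool) : Prop := ∀ k, 0 ≤ I.remaining t x k

/-- The cost of assigning `x_t = 1`. -/
def QPlus (t : Fin n) (x : Fin n → Bool) (k : Fin m) : ℤ :=
  ∑ S : Finset (Fin n) with (t ∈ S ∧ ∀ j ∈ S, j ≤ t) ∧ 0 ≤ I.w S k,
    |I.w S k| * prodVar x (S.erase t)

/-- The cost of assigning `x_t = 0`. -/
def QMinus (t : Fin n) (x : Fin n → Bool) (k : Fin m) : ℤ :=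
  ∑ S : Finset (Fin n) with I.w S k < 0 ∧ t ∈ S, |I.w S k| * prodVar x {j ∈ S | j < t}

/-- `κ`-bit two's complement integers (from `-2^(κ-1)` to `2^(κ-1) - 1`) suffice for the numbers
`c_k`, `-P_k` and `c_k + P_k`. -/
def FitsIn (κ : ℕ) : Prop :=
  ∀ k, -2 ^ (κ - 1) ≤ I.c k ∧ -2 ^ (κ - 1) ≤ -I.shift k ∧ I.c k + I.shift k < 2 ^ (κ - 1)

end SumConstraints

/-! ## Quantum circuits -/

/-- The rotation `R_y(θ)`; `false` and `true` index the basis vectors `|0⟩` and `|1⟩`. -/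
noncomputable def rotY (θ : ℝ) : Matrix Bool Bool ℂ := Matrix.of fun i j =>
  match i, j with
  | false, false => (Real.cos (θ / 2) : ℂ)
  | false, true => -(Real.sin (θ / 2) : ℂ)
  | true, false => (Real.sin (θ / 2) : ℂ)
  | true, true => (Real.cos (θ / 2) : ℂ)

/-- The `X` (NOT) gate. -/
def notX : Matrix Bool Bool ℂ := Matrix.of fun i j => if i = j then 0 else 1

/-- Elementary gates on qubits indexed by `Q`: arbitrary single-qubit unitaries, controlled
`R_y` rotations, CNOT and Toffoli. -/
inductive QGate (Q : Type) : Type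
  | single (q : Q) (u : Matrix.unitaryGroup Bool ℂ) : QGate Q
  | controlledRotY (c q : Q) (h : c ≠ q) (θ : ℝ) : QGate Q
  | cnot (c q : Q) (h : c ≠ q) : QGate Q
  | toffoli (c d q : Q) (hcd : c ≠ d) (hcq : c ≠ q) (hdq : d ≠ q) : QGate Q

section Circuits

variable {Q : Type} [DecidableEq Q]

/-- Apply to qubit `q` of the state `ψ` the `2 × 2` matrix `M b`, which the values of the
other qubits in the basis state `b` select. -/
def applyAt (q : Q) (M : (Q → Bool) → Matrix Bool Bool ℂ) (ψ : (Q → Bool) → ℂ) : (Q → Bool) → ℂ :=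
  fun b => ∑ a : Bool, M b (b q) a * ψ (Function.update b q a)

/-- The action of a gate on state vectors. -/
noncomputable def QGate.apply : QGate Q → ((Q → Bool) → ℂ) → ((Q → Bool) → ℂ)
  | .single q u => applyAt q fun _ => u.1
  | .controlledRotY c q _ θ => applyAt q fun b => if b c = true then rotY θ else 1
  | .cnot c q _ => applyAt q fun b => if b c = true then notX else 1
  | .toffoli c d q _ _ _ => applyAt q fun b => if b c = true ∧ b d = true then notX else 1

/-- The qubits on which a gate acts. -/
def QGate.qubits : QGate Q → Finset Q
  | .single q _ => {q}
  | .controlledRotY c q _ _ => {c, q}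
  | .cnot c q _ => {c, q}
  | .toffoli c d q _ _ _ => {c, d, q}

/-- One time step of a circuit: gates on pairwise disjoint sets of qubits. -/
structure QLayer (Q : Type) [DecidableEq Q] where
  gates : List (QGate Q)
  disjoint : gates.Pairwise fun g h => Disjoint g.qubits h.qubits

/-- A circuit is the list of its layers, the first one being executed first. Its depth is the
length of the list. -/
abbrev QCircuit (Q : Type) [DecidableEq Q] := List (QLayer Q)

/-- Run a circuit on a state. -/
noncomputable def QCircuit.run (C : QCircuit Q) (ψ : (Q → Bool) → ℂ) : (Q → Bool) → ℂ :=
  C.foldl (fun φ L => L.gates.foldl (fun χ g => g.apply χ) φ) ψ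

end Circuits

/-! ## The registers and the oracle -/

/-- The labels of the computational basis: the `n` variable qubits and the contents of the
`m` registers of `κ` qubits each, which store integers in two's complement. -/
abbrev RegConfig (n m κ : ℕ) := (Fin n → Bool) × (Fin m → BitVec κ)

/-- State vectors on the variable qubits and the `m` registers. -/
abbrev RegState (n m κ : ℕ) := RegConfig n m κ → ℂ

/-- The qubits: `n` for the variables, `κ` for each of the `m` registers, and `a` ancillas. -/
abbrev RegQubit (n m κ a : ℕ) := Fin n ⊕ (Fin m × Fin κ) ⊕ Fin a

/-- The values of all the qubits for a basis state of the registers, the ancillas being `0`. -/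
def encode {n m κ : ℕ} (a : ℕ) (s : RegConfig n m κ) : RegQubit n m κ a → Bool
  | .inl i => s.1 i
  | .inr (.inl (k, j)) => (s.2 k).getLsbD j
  | .inr (.inr _) => false

/-- The state `ψ ⊗ |0⟩^a`. -/
noncomputable def withAncillas {n m κ : ℕ} (a : ℕ) (ψ : RegState n m κ) :
    (RegQubit n m κ a → Bool) → ℂ :=
  Function.extend (encode a) ψ 0

/-- The circuit maps `ψ ⊗ |0⟩^a` to `(U ψ) ⊗ |0⟩^a` for every state `ψ` of the registers. -/
def Implements {n m κ a : ℕ} (C : QCircuit (RegQubit n m κ a))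
    (U : RegState n m κ → RegState n m κ) : Prop :=
  ∀ ψ, C.run (withAncillas a ψ) = withAncillas a (U ψ)

namespace SumConstraints

variable {n m κ : ℕ} (I : SumConstraints n m)

/-- The boolean `b⁺`: in every constraint the cost of `x_t = 1` is at most the register content. -/
def bPlus (t : Fin n) (s : RegConfig n m κ) : Prop := ∀ k, I.QPlus t s.1 k ≤ (s.2 k).toInt

/-- The boolean `b⁻`: in every constraint the cost of `x_t = 0` is at most the register content. -/
def bMinus (t : Fin n) (s : RegConfig n m κ) : Prop := ∀ k, I.QMinus t s.1 k ≤ (s.2 k).toInt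

open Classical in
/-- The operation on qubit `t`: `R_y(θ)` if `b⁺ ∧ b⁻`, `X` if `b⁺ ∧ ¬ b⁻`, else the identity. -/
noncomputable def branchGate (θ : ℝ) (t : Fin n) (s : RegConfig n m κ) : Matrix Bool Bool ℂ :=
  if I.bPlus t s ∧ I.bMinus t s then rotY θ
  else if I.bPlus t s ∧ ¬ I.bMinus t s then notX
  else 1

/-- The conditional assignment of the variable `t`. The gate does not depend on `x_t`. -/
noncomputable def branch (θ : ℝ) (t : Fin n) (ψ : RegState n m κ) : RegState n m κ := fun s =>
  ∑ a : Bool, I.branchGate θ t s (s.1 t) a * ψ (Function.update s.1 t a, s.2)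

/-- The cost that the value of `x_t` incurs. -/
def cost (t : Fin n) (x : Fin n → Bool) (k : Fin m) : ℤ :=
  if x t = true then I.QPlus t x k else I.QMinus t x k

/-- The controlled subtractions `|x⟩|r_1⟩⋯|r_m⟩ ↦ |x⟩|r_1 - Q_1⟩⋯|r_m - Q_m⟩` (modulo `2^κ`), where
`Q_k` is the cost of the value of `x_t`; the amplitude of `(x, r)` is therefore the former
amplitude of `(x, r + Q)`. -/
def subtract (t : Fin n) (ψ : RegState n m κ) : RegState n m κ := fun s =>
  ψ (s.1, fun k => s.2 k + BitVec.ofInt κ (I.cost t s.1 k))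

/-- The oracle for the variable `t`. -/
noncomputable def oracle (θ : ℝ) (t : Fin n) (ψ : RegState n m κ) : RegState n m κ :=
  I.subtract t (I.branch θ t ψ)

/-- The initial state `|0⟩^n |c_1 + P_1⟩ ⋯ |c_m + P_m⟩`. -/
noncomputable def initialState (κ : ℕ) : RegState n m κ :=
  Pi.single (fun _ => false, fun k => BitVec.ofInt κ (I.c k + I.shift k)) 1

/-- The state after the oracles of the first `t` variables. -/
noncomputable def stateAfter (κ : ℕ) (θ : Fin n → ℝ) : ℕ → RegState n m κ
  | 0 => I.initialState κ
  | t + 1 => if h : t < n then I.oracle (θ ⟨t, h⟩) ⟨t, h⟩ (stateAfter κ θ t) else stateAfter κ θ t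

/-- The assignment `x` (with zeros at the unassigned positions) occurs with a non-zero amplitude in
the superposition after `t` steps. -/
def Generated (κ : ℕ) (θ : Fin n → ℝ) (t : ℕ) (x : Fin n → Bool) : Prop :=
  ∃ r : Fin m → BitVec κ, I.stateAfter κ θ t (x, r) ≠ 0

end SumConstraints

/-!
The combinatorial part rests on one identity: when `x_t` is assigned, the products that become
closed are exactly those counted by the cost of the chosen value, so the remaining potentials drop
by that cost (`remaining_succ`). Hence `b⁺` and `b⁻` test whether the two successors are potentially
satisfiable (`costOf_le_iff`), and the gate on qubit `t` maps `|0⟩` to exactly the values that the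
theorem lists (`generated_succ_iff`). For this the registers must hold the true potentials and not
their residues modulo `2 ^ κ`. The only costs subtracted without a successful test are those of
`x_t = 0`; they come from negative coefficients, which are worth at most `P_k` in total, so the
potentials stay at or above `min(c_k, -P_k)` (`StateInvariant`).

For the circuits, a factor polynomial in `n` and a factor `m` are allowed in the depth, so that
monomials and registers can be processed one after the other with shared ancillas; only the
dependence on `κ` has to be logarithmic. This is achieved by a carry-lookahead adder with a complete
binary tree of `O(κ + n)` ancillas (`exists_carryTree`, `exists_condAdd`). Addition is done in
place: the carries of `u + w` are also the carries of `¬(u + w) + w` (`carry_not_add`), and so can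
be erased after the sum has replaced `u`. A cost is compared with a register by subtracting its
terms from a copy of `κ + n + 2` bits and reading off the sign; capping the coefficients at `2 ^ κ`
does not affect the comparison, and there are at most `2 ^ n` terms, so nothing overflows
(`msb_eq_false_iff_sum_le`).

Apart from one controlled rotation, the gates of each circuit are classical, that is, they permute
the basis states. Classical circuits are handled through the predicate `Realizable S d f`:
a classical circuit of depth at most `d` on the qubits in `S` acts on basis states as `f`.
Intermediate results are erased by running a circuit backwards (`Realizable.exists_conj`). The
circuit that computes `b⁺ ∧ b⁻` and `b⁺ ∧ ¬ b⁻` does not touch qubit `t`, so it commutes with the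
gates on this qubit and can be undone after them (`implements_oracle`).
-/

open Function

/-! ### Overwriting bits -/

/- Throughout, for an injective family of qubits `t` and a basis state `b`, `Function.extend t v b`
is the basis state in which the bit `t i` is overwritten by `v i` and all the other bits are as in
`b`. -/

lemma extend_of_forall_ne {ι α β : Type} {t : ι → α} {v : ι → β} {b : α → β} {q : α}
    (h : ∀ i, t i ≠ q) : extend t v b q = b q :=
  extend_apply' _ _ _ fun ⟨i, hi⟩ => h i hi

lemma extend_extend_same {ι α β : Type} (t : ι → α) (v v' : ι → β) (b : α → β) :
    extend t v (extend t v' b) = extend t v b := by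
  ext q
  by_cases h : ∃ i, t i = q
  · classical
    simp [extend, h]
  · rw [extend_apply' _ _ _ h, extend_apply' _ _ _ h, extend_apply' _ _ _ h]

lemma extend_extend_comm {ι ι' α β : Type} {t : ι → α} {t' : ι' → α} (h : ∀ i j, t i ≠ t' j)
    (v : ι → β) (v' : ι' → β) (b : α → β) :
    extend t v (extend t' v' b) = extend t' v' (extend t v b) := by
  classical
  ext q
  by_cases h1 : ∃ i, t i = q <;> by_cases h2 : ∃ i, t' i = q
  · obtain ⟨i, rfl⟩ := h1
    obtain ⟨j, hj⟩ := h2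
    exact absurd hj.symm (h i j)
  all_goals simp [extend, h1, h2]

lemma extend_eq_self {ι α β : Type} {t : ι → α} (ht : Injective t) {v : ι → β} {b : α → β}
    (h : ∀ i, v i = b (t i)) : extend t v b = b := by
  ext q
  by_cases hq : ∃ i, t i = q
  · obtain ⟨i, rfl⟩ := hq
    rw [ht.extend_apply, h]
  · rw [extend_apply' _ _ _ hq]

lemma extend_unit {Q : Type} [DecidableEq Q] (q : Q) (v : Unit → Bool) (b : Q → Bool) :
    extend (fun _ : Unit => q) v b = update b q (v ()) := by
  ext r
  by_cases h : r = q
  · subst h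
    rw [update_self, Injective.extend_apply (f := fun _ : Unit => r) (fun _ _ _ => rfl) _ _ ()]
  · rw [update_of_ne h, extend_apply' _ _ _ (by simpa using Ne.symm h)]

/-! ### Reversible classical circuits -/

namespace QGate

variable {Q : Type} [DecidableEq Q]

/-- The gate permutes the computational basis: it is `X`, CNOT or Toffoli. -/
def IsClassical : QGate Q → Prop
  | .single _ u => u.1 = notX
  | .controlledRotY _ _ _ _ => False
  | .cnot _ _ _ => True
  | .toffoli _ _ _ _ _ _ => True

/-- The only qubit that the gate can change. -/
def target : QGate Q → Q
  | .single q _ => q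
  | .controlledRotY _ q _ _ => q
  | .cnot _ q _ => q
  | .toffoli _ _ q _ _ _ => q

/-- Whether a classical gate flips its target in the basis state `b`. -/
def active : QGate Q → (Q → Bool) → Bool
  | .single _ _, _ => true
  | .controlledRotY _ _ _ _, _ => false
  | .cnot c _ _, b => b c
  | .toffoli c d _ _ _ _, b => b c && b d

/-- The action of a classical gate on basis states. -/
def flip (g : QGate Q) (b : Q → Bool) : Q → Bool :=
  update b g.target (b g.target ^^ g.active b)

lemma target_mem_qubits (g : QGate Q) : g.target ∈ g.qubits := by
  cases g <;> simp [target, qubits]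

lemma flip_of_ne (g : QGate Q) (b : Q → Bool) {q : Q} (h : q ≠ g.target) : g.flip b q = b q :=
  update_of_ne h _ _

lemma flip_target (g : QGate Q) (b : Q → Bool) : g.flip b g.target = (b g.target ^^ g.active b) :=
  update_self _ _ _

lemma active_congr (g : QGate Q) {b b' : Q → Bool} (h : ∀ q ∈ g.qubits, b q = b' q) :
    g.active b = g.active b' := by
  cases g <;> simp_all [active, qubits]

lemma active_flip (g : QGate Q) (b : Q → Bool) : g.active (g.flip b) = g.active b := by
  cases g with
  | single => rfl
  | controlledRotY => rfl
  | cnot c q h => simp [active, flip, target, h]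
  | toffoli c d q hcd hcq hdq => simp [active, flip, target, hcq, hdq]

lemma flip_flip (g : QGate Q) (b : Q → Bool) : g.flip (g.flip b) = b := by
  ext q
  by_cases h : q = g.target
  · subst h
    simp [flip_target, active_flip]
  · simp [flip_of_ne, h]

lemma apply_flip {g : QGate Q} (hg : g.IsClassical) (ψ : (Q → Bool) → ℂ) (b : Q → Bool) :
    g.apply ψ (g.flip b) = ψ b := by
  have key : ∀ b, g.apply ψ b = ψ (g.flip b) := by
    intro b
    cases g with
    | single q u =>
      simp only [IsClassical] at hg
      cases hb : b q <;> simp [apply, applyAt, hg, flip, target, active, notX, hb]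
    | controlledRotY => exact hg.elim
    | cnot c q h =>
      have hc : update b q (b q) = b := update_eq_self q b
      cases hb : b q <;> cases hbc : b c <;>
        simp_all [apply, applyAt, flip, target, active, notX, Matrix.one_apply]
    | toffoli c d q hcd hcq hdq =>
      have hc : update b q (b q) = b := update_eq_self q b
      cases hb : b q <;> cases hbc : b c <;> cases hbd : b d <;>
        simp_all [apply, applyAt, flip, target, active, notX, Matrix.one_apply]
  rw [key, flip_flip]

end QGate

lemma notX_mem_unitaryGroup : notX ∈ Matrix.unitaryGroup Bool ℂ := by
  rw [Matrix.mem_unitaryGroup_iff]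
  ext i j
  cases i <;> cases j <;> simp [notX, Matrix.mul_apply, Matrix.star_apply]

/-- The `X` gate on a qubit. -/
def QGate.notGate {Q : Type} (q : Q) : QGate Q := .single q ⟨notX, notX_mem_unitaryGroup⟩

/-- `f` changes only bits in `S`, in a way that depends only on bits in `S`. -/
def LocalOn {Q : Type} (S : Set Q) (f : (Q → Bool) → Q → Bool) : Prop :=
  (∀ b, ∀ q ∉ S, f b q = b q) ∧ ∀ b b', (∀ q ∈ S, b q = b' q) → ∀ q ∈ S, f b q = f b' q

lemma LocalOn.comp {Q : Type} {S : Set Q} {f g : (Q → Bool) → Q → Bool} (hf : LocalOn S f)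
    (hg : LocalOn S g) : LocalOn S fun b => g (f b) :=
  ⟨fun b q hq => (hg.1 _ q hq).trans (hf.1 b q hq), fun b b' h => hg.2 _ _ (hf.2 b b' h)⟩

section Circuits

variable {Q : Type} [DecidableEq Q]

/-- The action of a list of classical gates, the first one being executed first. -/
def flipAll (l : List (QGate Q)) (b : Q → Bool) : Q → Bool := l.foldl (fun b g => g.flip b) b

/-- The action of a classical circuit on basis states. -/
def QCircuit.act (C : QCircuit Q) (b : Q → Bool) : Q → Bool :=
  C.foldl (fun b L => flipAll L.gates b) b

/-- All the gates are classical and act on qubits in `S`. -/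
def QCircuit.ClassicalOn (S : Set Q) (C : QCircuit Q) : Prop :=
  ∀ L ∈ C, ∀ g ∈ L.gates, g.IsClassical ∧ (g.qubits : Set Q) ⊆ S

@[simp] lemma flipAll_nil (b : Q → Bool) : flipAll [] b = b := rfl

@[simp] lemma flipAll_cons (g : QGate Q) (l) (b : Q → Bool) :
    flipAll (g :: l) b = flipAll l (g.flip b) := rfl

lemma flipAll_append (l l' : List (QGate Q)) (b : Q → Bool) :
    flipAll (l ++ l') b = flipAll l' (flipAll l b) := by simp [flipAll]

lemma flipAll_reverse_flipAll (l : List (QGate Q)) (b : Q → Bool) :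
    flipAll l.reverse (flipAll l b) = b := by
  induction l generalizing b with
  | nil => rfl
  | cons g l ih => simp [flipAll_append, ih, QGate.flip_flip]

@[simp] lemma QCircuit.act_nil (b : Q → Bool) : QCircuit.act [] b = b := rfl

@[simp] lemma QCircuit.act_cons (L : QLayer Q) (C : QCircuit Q) (b : Q → Bool) :
    QCircuit.act (L :: C) b = QCircuit.act C (flipAll L.gates b) := rfl

lemma QCircuit.act_append (C D : QCircuit Q) (b : Q → Bool) :
    QCircuit.act (C ++ D) b = QCircuit.act D (QCircuit.act C b) := by simp [act]

lemma QCircuit.run_append (C D : QCircuit Q) (ψ : (Q → Bool) → ℂ) :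
    QCircuit.run (C ++ D) ψ = QCircuit.run D (QCircuit.run C ψ) := by simp [run]

/-- The circuit run backwards. -/
def QCircuit.inv (C : QCircuit Q) : QCircuit Q :=
  (C.map fun L => ⟨L.gates.reverse, by
    rw [List.pairwise_reverse]; exact L.disjoint.imp fun h => h.symm⟩).reverse

@[simp] lemma QCircuit.length_inv (C : QCircuit Q) : C.inv.length = C.length := by simp [inv]

lemma QCircuit.inv_inv (C : QCircuit Q) : C.inv.inv = C := by
  simp [inv, Function.comp_def]

lemma QCircuit.act_inv_act (C : QCircuit Q) (b : Q → Bool) : C.inv.act (C.act b) = b := by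
  induction C generalizing b with
  | nil => rfl
  | cons L C ih =>
    have : QCircuit.inv (L :: C) = QCircuit.inv C ++ QCircuit.inv [L] := by simp [inv]
    rw [this, act_append, act_cons, ih]
    simp [inv, flipAll_reverse_flipAll]

lemma QCircuit.act_act_inv (C : QCircuit Q) (b : Q → Bool) : C.act (C.inv.act b) = b := by
  simpa [inv_inv] using act_inv_act C.inv b

lemma QCircuit.ClassicalOn.inv {S : Set Q} {C : QCircuit Q} (h : ClassicalOn S C) :
    ClassicalOn S C.inv := by
  intro L hL g hg
  simp only [QCircuit.inv, List.mem_reverse, List.mem_map] at hL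
  obtain ⟨L', hL', rfl⟩ := hL
  exact h L' hL' g (by simpa using hg)

/-- A classical circuit moves the amplitude of `b` to `C.act b`. -/
lemma QCircuit.run_act {S : Set Q} {C : QCircuit Q} (hC : ClassicalOn S C)
    (ψ : (Q → Bool) → ℂ) (b : Q → Bool) : C.run ψ (C.act b) = ψ b := by
  have gates : ∀ (l : List (QGate Q)), (∀ g ∈ l, g.IsClassical) → ∀ (ψ : (Q → Bool) → ℂ) b,
      l.foldl (fun χ g => g.apply χ) ψ (flipAll l b) = ψ b := by
    intro l
    induction l with
    | nil => intros; rfl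
    | cons g l ih =>
      intro h ψ b
      simp only [List.foldl_cons, flipAll_cons]
      rw [ih (fun g' hg' => h g' (by simp [hg'])), QGate.apply_flip (h g (by simp))]
  induction C generalizing ψ b with
  | nil => rfl
  | cons L C ih =>
    have h1 : QCircuit.run (L :: C) ψ =
        QCircuit.run C (L.gates.foldl (fun χ g => g.apply χ) ψ) := rfl
    rw [h1, act_cons, ih (fun L' hL' => hC L' (by simp [hL'])),
      gates _ (fun g hg => (hC L (by simp) g hg).1)]

lemma QGate.localOn_flip {S : Set Q} (g : QGate Q) (hg : (g.qubits : Set Q) ⊆ S) :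
    LocalOn S g.flip := by
  refine ⟨fun b q hq => g.flip_of_ne b fun h => hq (h ▸ hg g.target_mem_qubits), ?_⟩
  intro b b' h q hq
  by_cases hqt : q = g.target
  · subst hqt
    rw [flip_target, flip_target, h _ hq, g.active_congr fun q hq => h q (hg hq)]
  · rw [g.flip_of_ne _ hqt, g.flip_of_ne _ hqt, h q hq]

lemma QCircuit.ClassicalOn.localOn {S : Set Q} {C : QCircuit Q} (hC : ClassicalOn S C) :
    LocalOn S C.act := by
  have gates : ∀ (l : List (QGate Q)), (∀ g ∈ l, (g.qubits : Set Q) ⊆ S) →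
      LocalOn S (flipAll l) := by
    intro l
    induction l with
    | nil => exact fun _ => ⟨fun _ _ _ => rfl, fun _ _ h => h⟩
    | cons g l ih =>
      exact fun h => (g.localOn_flip (h g (by simp))).comp (ih fun g' hg' => h g' (by simp [hg']))
  induction C with
  | nil => exact ⟨fun _ _ _ => rfl, fun _ _ h => h⟩
  | cons L C ih =>
    exact (gates L.gates fun g hg => (hC L (by simp) g hg).2).comp
      (ih fun L' hL' => hC L' (by simp [hL']))

/-- A classical circuit of depth at most `d` on the qubits in `S` acts on basis states as `f`. -/
def Realizable (S : Set Q) (d : ℕ) (f : (Q → Bool) → Q → Bool) : Prop :=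
  ∃ C : QCircuit Q, C.length ≤ d ∧ C.ClassicalOn S ∧ C.act = f

namespace Realizable

variable {S S' : Set Q} {d d' : ℕ} {f g : (Q → Bool) → Q → Bool}

lemma localOn (h : Realizable S d f) : LocalOn S f := by
  obtain ⟨C, -, hC, rfl⟩ := h
  exact hC.localOn

lemma apply_of_notMem (h : Realizable S d f) (b : Q → Bool) {q : Q} (hq : q ∉ S) : f b q = b q :=
  h.localOn.1 b q hq

lemma mono (h : Realizable S d f) (hS : S ⊆ S') (hd : d ≤ d') : Realizable S' d' f := by
  obtain ⟨C, h1, h2, h3⟩ := h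
  exact ⟨C, h1.trans hd, fun L hL g hg => ⟨(h2 L hL g hg).1, (h2 L hL g hg).2.trans hS⟩, h3⟩

lemma id : Realizable S 0 (fun b => b) :=
  ⟨[], le_rfl, fun _ h => by simp at h, rfl⟩

lemma comp (hf : Realizable S d f) (hg : Realizable S d' g) :
    Realizable S (d + d') fun b => g (f b) := by
  obtain ⟨C, h1, h2, rfl⟩ := hf
  obtain ⟨D, h1', h2', rfl⟩ := hg
  refine ⟨C ++ D, by simpa using Nat.add_le_add h1 h1', ?_, ?_⟩
  · intro L hL
    rcases List.mem_append.1 hL with h | h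
    exacts [h2 L h, h2' L h]
  · ext b
    rw [QCircuit.act_append]

lemma exists_inverse (hf : Realizable S d f) :
    ∃ f', Realizable S d f' ∧ (∀ b, f' (f b) = b) ∧ ∀ b, f (f' b) = b := by
  obtain ⟨C, h1, h2, rfl⟩ := hf
  exact ⟨C.inv.act, ⟨C.inv, by simpa using h1, h2.inv, rfl⟩, C.act_inv_act, C.act_act_inv⟩

/-- Compute with `f`, act with `g`, and uncompute. If, in the states that occur, `g` changes only
qubits that `f` does not touch, then the result is that change alone. -/
lemma exists_conj {ι : Type} {t : ι → Q} (hf : Realizable S d f) (hg : Realizable S' d' g)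
    (ht : ∀ i, t i ∉ S) (hS : S ⊆ S') :
    ∃ h, Realizable S' (2 * d + d') h ∧
      ∀ b v, g (f b) = extend t v (f b) → h b = extend t v b := by
  obtain ⟨f', hf', hinv, -⟩ := hf.exists_inverse
  refine ⟨fun b => f' (g (f b)), ?_, ?_⟩
  · exact (((hf.mono hS le_rfl).comp hg).comp (hf'.mono hS le_rfl)).mono le_rfl (by omega)
  · intro b v hb
    simp only [hb]
    have hout : ∀ (c : Q → Bool), ∀ q ∈ S, extend t v c q = c q := fun c q hq =>
      extend_apply' _ _ _ (by rintro ⟨i, rfl⟩; exact ht i hq)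
    ext q
    by_cases hq : q ∈ S
    · rw [hf'.localOn.2 _ _ (hout (f b)) q hq, hinv, hout _ _ hq]
    · rw [hf'.localOn.1 _ _ hq]
      by_cases hqt : ∃ i, t i = q
      · classical
        unfold extend
        simp [hqt]
      · rw [extend_apply' _ _ _ hqt, extend_apply' _ _ _ hqt, hf.localOn.1 _ _ hq]

/-- A layer of classical gates on disjoint sets of qubits flips all their active targets. -/
lemma of_layer {ι : Type} [Fintype ι] (g : ι → QGate Q) (hc : ∀ i, (g i).IsClassical)
    (hS : ∀ i, ((g i).qubits : Set Q) ⊆ S)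
    (hd : Pairwise fun i j => Disjoint (g i).qubits (g j).qubits) :
    Realizable S 1 fun b =>
      extend (fun i => (g i).target) (fun i => b (g i).target ^^ (g i).active b) b := by
  have hne : ∀ i j, i ≠ j → ∀ q ∈ (g i).qubits, q ≠ (g j).target := by
    rintro i j hij q hq rfl
    exact Finset.disjoint_left.1 (hd hij) hq (g j).target_mem_qubits
  have hinj : Injective fun i => (g i).target := by
    intro i j hij
    by_contra h
    exact hne i j h _ (g i).target_mem_qubits hij
  have hnodup : (Finset.univ : Finset ι).toList.Nodup := Finset.nodup_toList _
  refine ⟨[⟨(Finset.univ : Finset ι).toList.map g, ?_⟩], by simp, ?_, ?_⟩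
  · rw [List.pairwise_map]
    exact List.Pairwise.imp (fun h => hd h) hnodup
  · intro L hL g' hg'
    simp only [List.mem_singleton] at hL
    subst hL
    obtain ⟨i, -, rfl⟩ := List.mem_map.1 hg'
    exact ⟨hc i, hS i⟩
  · have key : ∀ l : List ι, l.Nodup → ∀ b : Q → Bool,
        (∀ i ∈ l, flipAll (l.map g) b (g i).target = (b (g i).target ^^ (g i).active b)) ∧
        ∀ q, (∀ i ∈ l, (g i).target ≠ q) → flipAll (l.map g) b q = b q := by
      intro l
      induction l with
      | nil => intro _ b; simp
      | cons i l ih =>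
        intro hl b
        obtain ⟨hil, hl⟩ := List.nodup_cons.1 hl
        obtain ⟨ih1, ih2⟩ := ih hl ((g i).flip b)
        constructor
        · intro j hj
          rw [List.map_cons, flipAll_cons]
          by_cases hji : j = i
          · subst hji
            rw [ih2 _ fun k hk h => hil ((hinj h : k = j) ▸ hk), QGate.flip_target]
          · rw [ih1 j ((List.mem_cons.1 hj).resolve_left hji),
              QGate.flip_of_ne _ _ (hne j i hji _ (g j).target_mem_qubits),
              QGate.active_congr _ fun q hq => QGate.flip_of_ne _ _ (hne j i hji q hq)]
        · intro q hq
          rw [List.map_cons, flipAll_cons, ih2 q fun j hj => hq j (by simp [hj]),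
            QGate.flip_of_ne _ _ (hq i (by simp)).symm]
    ext b q
    obtain ⟨h1, h2⟩ := key _ hnodup b
    by_cases hq : ∃ i, (g i).target = q
    · obtain ⟨i, rfl⟩ := hq
      rw [hinj.extend_apply]
      simpa using h1 i (by simp)
    · rw [extend_apply' _ _ _ hq]
      simpa using h2 q fun i _ h => hq ⟨i, h⟩

lemma not_layer {ι : Type} [Fintype ι] (t : ι → Q) (ht : Injective t) (hS : ∀ i, t i ∈ S) :
    Realizable S 1 fun b => extend t (fun i => !b (t i)) b := by
  have := of_layer (S := S) (fun i => QGate.notGate (t i)) (fun i => rfl)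
    (by simpa [QGate.notGate, QGate.qubits] using hS) (by
      intro i j hij
      simpa [QGate.notGate, QGate.qubits] using fun h => hij (ht h))
  simpa [QGate.notGate, QGate.target, QGate.active] using this

lemma cnot_layer {ι : Type} [Fintype ι] (c t : ι → Q) (hc : Injective c) (ht : Injective t)
    (hct : ∀ i j, c i ≠ t j) (hcS : ∀ i, c i ∈ S) (htS : ∀ i, t i ∈ S) :
    Realizable S 1 fun b => extend t (fun i => b (t i) ^^ b (c i)) b := by
  have := of_layer (S := S) (fun i => QGate.cnot (c i) (t i) (hct i i)) (fun i => trivial)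
    (by simp [QGate.qubits, Set.insert_subset_iff, hcS, htS]) (by
      intro i j hij
      simp [QGate.qubits, hct, (hct _ _).symm, hc.eq_iff, ht.eq_iff, Ne.symm hij])
  simpa [QGate.target, QGate.active] using this

lemma toffoli_layer {ι : Type} [Fintype ι] (c e t : ι → Q) (hc : Injective c) (he : Injective e)
    (ht : Injective t) (hce : ∀ i j, c i ≠ e j) (hct : ∀ i j, c i ≠ t j) (het : ∀ i j, e i ≠ t j)
    (hcS : ∀ i, c i ∈ S) (heS : ∀ i, e i ∈ S) (htS : ∀ i, t i ∈ S) :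
    Realizable S 1 fun b => extend t (fun i => b (t i) ^^ (b (c i) && b (e i))) b := by
  have := of_layer (S := S)
    (fun i => QGate.toffoli (c i) (e i) (t i) (hce i i) (hct i i) (het i i)) (fun i => trivial)
    (by simp [QGate.qubits, Set.insert_subset_iff, hcS, htS, heS]) (by
      intro i j hij
      simp [QGate.qubits, hct, (hct _ _).symm, hce, (hce _ _).symm, het, (het _ _).symm,
        hc.eq_iff, ht.eq_iff, he.eq_iff, Ne.symm hij])
  simpa [QGate.target, QGate.active] using this

lemma not_gate (q : Q) (hq : q ∈ S) : Realizable S 1 fun b => update b q (!b q) := by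
  have := not_layer (S := S) (fun _ : Unit => q) (fun _ _ _ => rfl) fun _ => hq
  simpa only [extend_unit] using this

lemma cnot_gate (c q : Q) (h : c ≠ q) (hc : c ∈ S) (hq : q ∈ S) :
    Realizable S 1 fun b => update b q (b q ^^ b c) := by
  have := cnot_layer (S := S) (fun _ : Unit => c) (fun _ : Unit => q) (fun _ _ _ => rfl)
    (fun _ _ _ => rfl) (fun _ _ => h) (fun _ => hc) (fun _ => hq)
  simpa only [extend_unit] using this

lemma toffoli_gate (c e q : Q) (hce : c ≠ e) (hcq : c ≠ q) (heq : e ≠ q) (hc : c ∈ S)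
    (he : e ∈ S) (hq : q ∈ S) :
    Realizable S 1 fun b => update b q (b q ^^ (b c && b e)) := by
  have := toffoli_layer (S := S) (fun _ : Unit => c) (fun _ : Unit => e) (fun _ : Unit => q)
    (fun _ _ _ => rfl) (fun _ _ _ => rfl) (fun _ _ _ => rfl) (fun _ _ => hce) (fun _ _ => hcq)
    (fun _ _ => heq) (fun _ => hc) (fun _ => he) (fun _ => hq)
  simpa only [extend_unit] using this

end Realizable

end Circuits

/-! ### Carry-lookahead addition -/

/-- The carry into position `i` when position `j` generates a carry if `g j` and propagates one
if `p j`. -/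
def prefixCarry (g p : ℕ → Bool) : ℕ → Bool
  | 0 => false
  | i + 1 => g i ^^ (p i && prefixCarry g p i)

/-- Combining neighbouring positions in pairs leaves the carries into even positions unchanged. -/
lemma prefixCarry_pair (g p : ℕ → Bool) (i : ℕ) :
    prefixCarry (fun v => g (2 * v + 1) ^^ (p (2 * v + 1) && g (2 * v)))
      (fun v => p (2 * v + 1) && p (2 * v)) i = prefixCarry g p (2 * i) := by
  induction i with
  | zero => rfl
  | succ i ih =>
    rw [prefixCarry, ih, show 2 * (i + 1) = 2 * i + 1 + 1 by ring, prefixCarry, prefixCarry]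
    cases g (2 * i + 1) <;> cases p (2 * i + 1) <;> cases g (2 * i) <;> cases p (2 * i) <;>
      cases prefixCarry g p (2 * i) <;> rfl

lemma prefixCarry_congr {g p g' p' : ℕ → Bool} {i : ℕ} (hg : ∀ j < i, g j = g' j)
    (hp : ∀ j < i, p j = p' j) : prefixCarry g p i = prefixCarry g' p' i := by
  induction i with
  | zero => rfl
  | succ i ih =>
    rw [prefixCarry, prefixCarry, hg i (by omega), hp i (by omega),
      ih (fun j hj => hg j (by omega)) fun j hj => hp j (by omega)]

lemma prefixCarry_eq_carry {K : ℕ} (u w : BitVec K) (i : ℕ) :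
    prefixCarry (fun j => u.getLsbD j && w.getLsbD j) (fun j => u.getLsbD j ^^ w.getLsbD j) i =
      BitVec.carry i u w false := by
  induction i with
  | zero => simp [prefixCarry]
  | succ i ih =>
    rw [prefixCarry, ih, BitVec.carry_succ]
    cases u.getLsbD i <;> cases w.getLsbD i <;> cases BitVec.carry i u w false <;> rfl

/-- The carries of `u + w` can be recovered from the sum, which allows addition in place. -/
lemma carry_not_add {K : ℕ} (u w : BitVec K) {i : ℕ} (hi : i ≤ K) :
    BitVec.carry i (~~~(u + w)) w false = BitVec.carry i u w false := by
  induction i with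
  | zero => simp
  | succ i ih =>
    rw [BitVec.carry_succ, BitVec.carry_succ, ih (by omega), BitVec.getLsbD_not,
      BitVec.getLsbD_add (by omega), decide_eq_true (show i < K by omega)]
    cases u.getLsbD i <;> cases w.getLsbD i <;> cases BitVec.carry i u w false <;> rfl

/-- `T a ℓ v` for `ℓ ≤ h` and `v < 2 ^ ℓ` are distinct qubits: three (for a generate bit,
a propagate bit and a carry, in this order) at each node of a complete binary tree, `ℓ` being the
level. -/
def IsTree {Q : Type} (h : ℕ) (T : Fin 3 → ℕ → ℕ → Q) : Prop :=
  ∀ a ℓ v a' ℓ' v', ℓ ≤ h → v < 2 ^ ℓ → ℓ' ≤ h → v' < 2 ^ ℓ' →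
    T a ℓ v = T a' ℓ' v' → a = a' ∧ ℓ = ℓ' ∧ v = v'

/-- The qubits of the levels up to `ℓ`. -/
def treeQubits {Q : Type} (T : Fin 3 → ℕ → ℕ → Q) (ℓ : ℕ) : Set Q :=
  {q | ∃ a j v, j ≤ ℓ ∧ v < 2 ^ j ∧ q = T a j v}

section Adder

variable {Q : Type} [DecidableEq Q]

/-- From generate and propagate bits at level `ℓ`, the carries at level `ℓ` are obtained by
combining the bits in pairs at level `ℓ - 1`, finding the carries there, and passing them down. -/
lemma exists_carryTree {h : ℕ} {T : Fin 3 → ℕ → ℕ → Q} (hT : IsTree h T) {ℓ : ℕ} (hℓ : ℓ ≤ h) :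
    ∃ f, Realizable (treeQubits T ℓ) (6 * ℓ) f ∧ ∀ b : Q → Bool,
      (∀ a, ∀ j < ℓ, ∀ v < 2 ^ j, b (T a j v) = false) →
      (∀ v < 2 ^ ℓ, b (T 2 ℓ v) = false) → ∀ v < 2 ^ ℓ,
      f b (T 2 ℓ v) = prefixCarry (fun i => b (T 0 ℓ i)) (fun i => b (T 1 ℓ i)) v := by
  induction ℓ with
  | zero =>
    refine ⟨_, Realizable.id, fun b _ hb v hv => ?_⟩
    obtain rfl : v = 0 := by simpa using hv
    simpa [prefixCarry] using hb 0 (by simp)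
  | succ ℓ ih =>
    obtain ⟨f, hf, hfb⟩ := ih (by omega)
    set S := treeQubits T (ℓ + 1) with hSdef
    have hSub : treeQubits T ℓ ⊆ S := by
      rintro q ⟨a, j, v, hj, hv, rfl⟩
      exact ⟨a, j, v, by omega, hv, rfl⟩
    have pow : 2 ^ (ℓ + 1) = 2 * 2 ^ ℓ := by ring
    have mem : ∀ a j v, j ≤ ℓ + 1 → v < 2 ^ j → T a j v ∈ S := fun a j v hj hv =>
      ⟨a, j, v, hj, hv, rfl⟩
    have v0 : ∀ i : Fin (2 ^ ℓ), 2 * i.val < 2 ^ (ℓ + 1) := fun i => by omega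
    have v1 : ∀ i : Fin (2 ^ ℓ), 2 * i.val + 1 < 2 ^ (ℓ + 1) := fun i => by omega
    have ne : ∀ {a j v a' j' v'}, j ≤ ℓ + 1 → v < 2 ^ j → j' ≤ ℓ + 1 → v' < 2 ^ j' →
        (a ≠ a' ∨ j ≠ j' ∨ v ≠ v') → T a j v ≠ T a' j' v' := by
      intro a j v a' j' v' h1 h2 h3 h4 h5 h6
      obtain ⟨rfl, rfl, rfl⟩ := hT _ _ _ _ _ _ (by omega) h2 (by omega) h4 h6
      simp at h5
    have injU : ∀ a, Injective fun i : Fin (2 ^ ℓ) => T a ℓ i := fun a i j hij =>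
      Fin.ext (hT _ _ _ _ _ _ (by omega) i.2 (by omega) j.2 hij).2.2
    have inj0 : ∀ a, Injective fun i : Fin (2 ^ ℓ) => T a (ℓ + 1) (2 * i) := fun a i j hij => by
      have := (hT _ _ _ _ _ _ hℓ (v0 i) hℓ (v0 j) hij).2.2
      omega
    have inj1 : ∀ a, Injective fun i : Fin (2 ^ ℓ) => T a (ℓ + 1) (2 * i + 1) := fun a i j hij => by
      have := (hT _ _ _ _ _ _ hℓ (v1 i) hℓ (v1 j) hij).2.2
      omega
    have up1 := Realizable.cnot_layer (S := S) (fun i : Fin (2 ^ ℓ) => T 0 (ℓ + 1) (2 * i + 1))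
      (fun i => T 0 ℓ i) (inj1 0) (injU 0)
      (fun i j => ne le_rfl (v1 i) (by omega) j.2 (by omega))
      (fun i => mem _ _ _ le_rfl (v1 i)) fun i => mem _ _ _ (by omega) i.2
    have up2 := Realizable.toffoli_layer (S := S) (fun i : Fin (2 ^ ℓ) => T 1 (ℓ + 1) (2 * i + 1))
      (fun i => T 0 (ℓ + 1) (2 * i)) (fun i => T 0 ℓ i) (inj1 1) (inj0 0) (injU 0)
      (fun i j => ne le_rfl (v1 i) le_rfl (v0 j) (by simp))
      (fun i j => ne le_rfl (v1 i) (by omega) j.2 (by simp))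
      (fun i j => ne le_rfl (v0 i) (by omega) j.2 (by simp))
      (fun i => mem _ _ _ le_rfl (v1 i)) (fun i => mem _ _ _ le_rfl (v0 i))
      fun i => mem _ _ _ (by omega) i.2
    have up3 := Realizable.toffoli_layer (S := S) (fun i : Fin (2 ^ ℓ) => T 1 (ℓ + 1) (2 * i + 1))
      (fun i => T 1 (ℓ + 1) (2 * i)) (fun i => T 1 ℓ i) (inj1 1) (inj0 1) (injU 1)
      (fun i j => ne le_rfl (v1 i) le_rfl (v0 j) (by omega))
      (fun i j => ne le_rfl (v1 i) (by omega) j.2 (by simp))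
      (fun i j => ne le_rfl (v0 i) (by omega) j.2 (by simp))
      (fun i => mem _ _ _ le_rfl (v1 i)) (fun i => mem _ _ _ le_rfl (v0 i))
      fun i => mem _ _ _ (by omega) i.2
    have down1 := Realizable.cnot_layer (S := S) (fun i : Fin (2 ^ ℓ) => T 2 ℓ i)
      (fun i => T 2 (ℓ + 1) (2 * i)) (injU 2) (inj0 2)
      (fun i j => ne (by omega) i.2 le_rfl (v0 j) (by simp))
      (fun i => mem _ _ _ (by omega) i.2) fun i => mem _ _ _ le_rfl (v0 i)
    have down2 := Realizable.cnot_layer (S := S) (fun i : Fin (2 ^ ℓ) => T 0 (ℓ + 1) (2 * i))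
      (fun i => T 2 (ℓ + 1) (2 * i + 1)) (inj0 0) (inj1 2)
      (fun i j => ne le_rfl (v0 i) le_rfl (v1 j) (by simp))
      (fun i => mem _ _ _ le_rfl (v0 i)) fun i => mem _ _ _ le_rfl (v1 i)
    have down3 := Realizable.toffoli_layer (S := S) (fun i : Fin (2 ^ ℓ) => T 1 (ℓ + 1) (2 * i))
      (fun i => T 2 ℓ i) (fun i => T 2 (ℓ + 1) (2 * i + 1)) (inj0 1) (injU 2) (inj1 2)
      (fun i j => ne le_rfl (v0 i) (by omega) j.2 (by simp))
      (fun i j => ne le_rfl (v0 i) le_rfl (v1 j) (by simp))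
      (fun i j => ne (by omega) i.2 le_rfl (v1 j) (by simp))
      (fun i => mem _ _ _ le_rfl (v0 i)) (fun i => mem _ _ _ (by omega) i.2)
      fun i => mem _ _ _ le_rfl (v1 i)
    -- up to level `ℓ`, the recursive step, and down to level `ℓ + 1`
    refine ⟨_, ((((((up1.comp up2).comp up3).comp (hf.mono hSub le_rfl)).comp down1).comp
      down2).comp down3).mono le_rfl (by omega), ?_⟩
    intro b hclean hC v hv
    -- the states between the layers
    set b1 := extend (fun i : Fin (2 ^ ℓ) => T 0 ℓ i)
      (fun i => b (T 0 ℓ i) ^^ b (T 0 (ℓ + 1) (2 * i + 1))) b with hb1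
    set b2 := extend (fun i : Fin (2 ^ ℓ) => T 0 ℓ i)
      (fun i => b1 (T 0 ℓ i) ^^ (b1 (T 1 (ℓ + 1) (2 * i + 1)) && b1 (T 0 (ℓ + 1) (2 * i)))) b1
      with hb2
    set b3 := extend (fun i : Fin (2 ^ ℓ) => T 1 ℓ i)
      (fun i => b2 (T 1 ℓ i) ^^ (b2 (T 1 (ℓ + 1) (2 * i + 1)) && b2 (T 1 (ℓ + 1) (2 * i)))) b2
      with hb3
    set b4 := f b3 with hb4
    set b5 := extend (fun i : Fin (2 ^ ℓ) => T 2 (ℓ + 1) (2 * i))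
      (fun i => b4 (T 2 (ℓ + 1) (2 * i)) ^^ b4 (T 2 ℓ i)) b4 with hb5
    set b6 := extend (fun i : Fin (2 ^ ℓ) => T 2 (ℓ + 1) (2 * i + 1))
      (fun i => b5 (T 2 (ℓ + 1) (2 * i + 1)) ^^ b5 (T 0 (ℓ + 1) (2 * i))) b5 with hb6
    have low1 : ∀ a v, v < 2 ^ (ℓ + 1) → b1 (T a (ℓ + 1) v) = b (T a (ℓ + 1) v) := fun a v hv =>
      extend_of_forall_ne fun i => ne (by omega) i.2 le_rfl hv (by simp)
    have low2 : ∀ a v, v < 2 ^ (ℓ + 1) → b2 (T a (ℓ + 1) v) = b (T a (ℓ + 1) v) := fun a v hv =>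
      (extend_of_forall_ne fun i => ne (by omega) i.2 le_rfl hv (by simp)).trans (low1 a v hv)
    have low3 : ∀ a v, v < 2 ^ (ℓ + 1) → b3 (T a (ℓ + 1) v) = b (T a (ℓ + 1) v) := fun a v hv =>
      (extend_of_forall_ne fun i => ne (by omega) i.2 le_rfl hv (by simp)).trans (low2 a v hv)
    have low4 : ∀ a v, v < 2 ^ (ℓ + 1) → b4 (T a (ℓ + 1) v) = b (T a (ℓ + 1) v) := by
      intro a v hv
      refine (hf.apply_of_notMem _ ?_).trans (low3 a v hv)
      rintro ⟨a', j, v', hj, hv', h⟩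
      exact ne le_rfl hv (by omega) hv' (by omega) h
    have g3 : ∀ i < 2 ^ ℓ, b3 (T 0 ℓ i) =
        (b (T 0 (ℓ + 1) (2 * i + 1)) ^^
          (b (T 1 (ℓ + 1) (2 * i + 1)) && b (T 0 (ℓ + 1) (2 * i)))) := by
      intro i hi
      rw [hb3, extend_of_forall_ne fun j => ne (by omega) j.2 (by omega) hi (by simp), hb2,
        (injU 0).extend_apply _ _ ⟨i, hi⟩, low1 _ _ (by omega), low1 _ _ (by omega), hb1,
        (injU 0).extend_apply _ _ ⟨i, hi⟩]
      simp [hclean 0 ℓ (by omega) i hi]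
    have p3 : ∀ i < 2 ^ ℓ, b3 (T 1 ℓ i) =
        (b (T 1 (ℓ + 1) (2 * i + 1)) && b (T 1 (ℓ + 1) (2 * i))) := by
      intro i hi
      rw [hb3, (injU 1).extend_apply _ _ ⟨i, hi⟩, low2 _ _ (by omega), low2 _ _ (by omega), hb2,
        extend_of_forall_ne fun j => ne (by omega) j.2 (by omega) hi (by simp), hb1,
        extend_of_forall_ne fun j => ne (by omega) j.2 (by omega) hi (by simp)]
      simp [hclean 1 ℓ (by omega) i hi]
    have clean3 : ∀ a j v, j ≤ ℓ → v < 2 ^ j → (a = 2 ∨ j ≠ ℓ) → b3 (T a j v) = false := by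
      intro a j v hj hv h
      rw [hb3, extend_of_forall_ne fun i => ne (by omega) i.2 (by omega) hv (by grind), hb2,
        extend_of_forall_ne fun i => ne (by omega) i.2 (by omega) hv (by grind), hb1,
        extend_of_forall_ne fun i => ne (by omega) i.2 (by omega) hv (by grind)]
      exact hclean a j (by omega) v hv
    have c4 : ∀ i < 2 ^ ℓ, b4 (T 2 ℓ i) =
        prefixCarry (fun i => b (T 0 (ℓ + 1) i)) (fun i => b (T 1 (ℓ + 1) i)) (2 * i) := by
      intro i hi
      rw [hb4, hfb b3 (fun a j hj v hv => clean3 a j v hj.le hv (by omega))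
        (fun v hv => clean3 2 ℓ v le_rfl hv (by simp)) i hi, ← prefixCarry_pair]
      exact prefixCarry_congr (fun j hj => g3 j (by omega)) fun j hj => p3 j (by omega)
    have c5 : ∀ i < 2 ^ ℓ, b5 (T 2 ℓ i) = b4 (T 2 ℓ i) := fun i hi =>
      extend_of_forall_ne fun j => ne le_rfl (v0 j) (by omega) hi (by simp)
    have c6 : ∀ i < 2 ^ ℓ, b6 (T 2 ℓ i) = b4 (T 2 ℓ i) := fun i hi =>
      (extend_of_forall_ne fun j => ne le_rfl (v1 j) (by omega) hi (by simp)).trans (c5 i hi)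
    change extend (fun i : Fin (2 ^ ℓ) => T 2 (ℓ + 1) (2 * i + 1))
      (fun i => b6 (T 2 (ℓ + 1) (2 * i + 1)) ^^ (b6 (T 1 (ℓ + 1) (2 * i)) && b6 (T 2 ℓ i))) b6
      (T 2 (ℓ + 1) v) = _
    obtain ⟨i, rfl | rfl⟩ : ∃ i, v = 2 * i ∨ v = 2 * i + 1 := ⟨v / 2, by omega⟩
    · rw [extend_of_forall_ne fun j => ne le_rfl (v1 j) le_rfl hv (by omega), hb6,
        extend_of_forall_ne fun j => ne le_rfl (v1 j) le_rfl hv (by omega), hb5,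
        (inj0 2).extend_apply _ _ ⟨i, by omega⟩]
      simp only
      rw [low4 _ _ hv, hC _ hv, c4 i (by omega)]
      simp
    · rw [(inj1 2).extend_apply _ _ ⟨i, by omega⟩]
      simp only
      rw [c6 i (by omega), c4 i (by omega), hb6, (inj1 2).extend_apply _ _ ⟨i, by omega⟩]
      simp only
      rw [extend_of_forall_ne fun j => ne le_rfl (v1 j) le_rfl (by omega) (by simp), hb5,
        extend_of_forall_ne fun j => ne le_rfl (v0 j) le_rfl hv (by omega),
        extend_of_forall_ne fun j => ne le_rfl (v0 j) le_rfl (by omega) (by simp),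
        extend_of_forall_ne fun j => ne le_rfl (v0 j) le_rfl (by omega) (by simp),
        low4 _ _ hv, hC _ hv, low4 _ _ (by omega), low4 _ _ (by omega), prefixCarry]
      simp

end Adder

/-- Work qubits for adding a number to a register of at most `2 ^ h` qubits: a tree for the carry
computation, and three rows, which hold copies of a control bit, the summand and the carries, in
this order. -/
structure AdderSpace (h : ℕ) (Q : Type) where
  T : Fin 3 → ℕ → ℕ → Q
  R : Fin 3 → ℕ → Q
  isTree : IsTree h T
  row_inj : ∀ a i a' i', i < 2 ^ h → i' < 2 ^ h → R a i = R a' i' → a = a' ∧ i = i'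
  tree_ne_row : ∀ a j v a' i, j ≤ h → v < 2 ^ j → i < 2 ^ h → T a j v ≠ R a' i

namespace AdderSpace

/-- The set of the work qubits. -/
def qubits {h : ℕ} {Q : Type} (A : AdderSpace h Q) : Set Q :=
  treeQubits A.T h ∪ {q | ∃ a i, i < 2 ^ h ∧ q = A.R a i}

variable {h K : ℕ} {Q : Type} [DecidableEq Q]

/-- The carries of the sum of the register and the summand row are added to the carry row. -/
lemma exists_xorCarry (A : AdderSpace h Q) (hK : K ≤ 2 ^ h) {reg : Fin K → Q}
    (hreg : Injective reg) (hregA : ∀ i, reg i ∉ A.qubits) :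
    ∃ f, Realizable (A.qubits ∪ Set.range reg) (12 * h + 7) f ∧
      ∀ (b : Q → Bool) (u w : BitVec K), (∀ q ∈ treeQubits A.T h, b q = false) →
        (∀ i, b (reg i) = u.getLsbD i) → (∀ i : Fin K, b (A.R 1 i) = w.getLsbD i) →
        f b = extend (fun i : Fin K => A.R 2 i)
          (fun i => b (A.R 2 i) ^^ BitVec.carry i u w false) b := by
  have lt : ∀ i : Fin K, i.val < 2 ^ h := fun i => by omega
  have tmem : ∀ a j v, j ≤ h → v < 2 ^ j → A.T a j v ∈ A.qubits := fun a j v hj hv =>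
    Or.inl ⟨a, j, v, hj, hv, rfl⟩
  have rmem : ∀ a i, i < 2 ^ h → A.R a i ∈ A.qubits := fun a i hi => Or.inr ⟨a, i, hi, rfl⟩
  have reg_ne : ∀ i q, q ∈ A.qubits → reg i ≠ q := fun i q hq h => hregA i (h ▸ hq)
  have injT : ∀ a, Injective fun i : Fin K => A.T a h i := fun a i j hij =>
    Fin.ext (A.isTree _ _ _ _ _ _ le_rfl (lt i) le_rfl (lt j) hij).2.2
  have injR : ∀ a, Injective fun i : Fin K => A.R a i := fun a i j hij =>
    Fin.ext (A.row_inj _ _ _ _ (lt i) (lt j) hij).2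
  have neT : ∀ a a' i i', a ≠ a' → i < 2 ^ h → i' < 2 ^ h → A.T a h i ≠ A.T a' h i' :=
    fun a a' i i' ha hi hi' h => ha (A.isTree _ _ _ _ _ _ le_rfl hi le_rfl hi' h).1
  have neR : ∀ a a' i i', a ≠ a' → i < 2 ^ h → i' < 2 ^ h → A.R a i ≠ A.R a' i' :=
    fun a a' i i' ha hi hi' h => ha (A.row_inj _ _ _ _ hi hi' h).1
  set S : Set Q := treeQubits A.T h ∪ Set.range reg ∪ Set.range fun i : Fin K => A.R 1 i with hS
  have memT : ∀ a (i : Fin K), A.T a h i ∈ S := fun a i =>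
    Or.inl (Or.inl ⟨a, h, i, le_rfl, lt i, rfl⟩)
  have memReg : ∀ i, reg i ∈ S := fun i => Or.inl (Or.inr ⟨i, rfl⟩)
  have memW : ∀ i : Fin K, A.R 1 i ∈ S := fun i => Or.inr ⟨i, rfl⟩
  obtain ⟨f, hf, hfb⟩ := exists_carryTree A.isTree le_rfl
  have l1 := Realizable.toffoli_layer (S := S) reg (fun i : Fin K => A.R 1 i)
    (fun i => A.T 0 h i) hreg (injR 1) (injT 0) (fun i j => reg_ne i _ (rmem _ _ (lt j)))
    (fun i j => reg_ne i _ (tmem _ _ _ le_rfl (lt j)))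
    (fun i j => (A.tree_ne_row _ _ _ _ _ le_rfl (lt j) (lt i)).symm) memReg memW (memT 0)
  have l2 := Realizable.cnot_layer (S := S) reg (fun i : Fin K => A.T 1 h i) hreg (injT 1)
    (fun i j => reg_ne i _ (tmem _ _ _ le_rfl (lt j))) memReg (memT 1)
  have l3 := Realizable.cnot_layer (S := S) (fun i : Fin K => A.R 1 i)
    (fun i : Fin K => A.T 1 h i) (injR 1) (injT 1)
    (fun i j => (A.tree_ne_row _ _ _ _ _ le_rfl (lt j) (lt i)).symm) memW (memT 1)
  have hcomp := ((l1.comp l2).comp l3).comp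
    (hf.mono (fun q hq => Or.inl (Or.inl hq)) le_rfl)
  have copy := Realizable.cnot_layer (S := A.qubits ∪ Set.range reg)
    (fun i : Fin K => A.T 2 h i) (fun i => A.R 2 i) (injT 2) (injR 2)
    (fun i j => A.tree_ne_row _ _ _ _ _ le_rfl (lt i) (lt j))
    (fun i => Or.inl (tmem _ _ _ le_rfl (lt i))) fun i => Or.inl (rmem _ _ (lt i))
  have outS : ∀ i : Fin K, A.R 2 i ∉ S := by
    rintro i ((⟨a, j, v, hj, hv, h'⟩ | ⟨j, hj⟩) | ⟨j, hj⟩)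
    · exact A.tree_ne_row _ _ _ _ _ hj hv (lt i) h'.symm
    · exact reg_ne j _ (rmem _ _ (lt i)) hj
    · exact neR _ _ _ _ (by decide) (lt j) (lt i) hj
  have hsub : S ⊆ A.qubits ∪ Set.range reg := by
    rintro q ((hq | hq) | ⟨j, rfl⟩)
    exacts [Or.inl (Or.inl hq), Or.inr hq, Or.inl (rmem _ _ (lt j))]
  obtain ⟨g, hg, hgb⟩ := hcomp.exists_conj copy outS hsub
  refine ⟨g, hg.mono le_rfl (by omega), fun b u w hT hu hw => hgb b _ ?_⟩
  have clean : ∀ a j v, j ≤ h → v < 2 ^ j → b (A.T a j v) = false := fun a j v hj hv =>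
    hT _ ⟨a, j, v, hj, hv, rfl⟩
  set b1 := extend (fun i : Fin K => A.T 0 h i)
    (fun i => b (A.T 0 h i) ^^ (b (reg i) && b (A.R 1 i))) b with hb1
  set b2 := extend (fun i : Fin K => A.T 1 h i) (fun i => b1 (A.T 1 h i) ^^ b1 (reg i)) b1 with hb2
  set b3 := extend (fun i : Fin K => A.T 1 h i) (fun i => b2 (A.T 1 h i) ^^ b2 (A.R 1 i)) b2
    with hb3
  have g3 : ∀ i < K, b3 (A.T 0 h i) = (u.getLsbD i && w.getLsbD i) := by
    intro i hi
    rw [hb3, extend_of_forall_ne fun j => neT _ _ _ _ (by decide) (lt j) (lt ⟨i, hi⟩), hb2,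
      extend_of_forall_ne fun j => neT _ _ _ _ (by decide) (lt j) (lt ⟨i, hi⟩), hb1,
      (injT 0).extend_apply _ _ ⟨i, hi⟩, clean _ _ _ le_rfl (lt ⟨i, hi⟩), hu, hw]
    simp
  have p3 : ∀ i < K, b3 (A.T 1 h i) = (u.getLsbD i ^^ w.getLsbD i) := by
    intro i hi
    rw [hb3, (injT 1).extend_apply _ _ ⟨i, hi⟩, hb2, (injT 1).extend_apply _ _ ⟨i, hi⟩]
    simp only
    rw [extend_of_forall_ne fun j => A.tree_ne_row _ _ _ _ _ le_rfl (lt j) (lt ⟨i, hi⟩), hb1,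
      extend_of_forall_ne fun j => neT _ _ _ _ (by decide) (lt j) (lt ⟨i, hi⟩),
      extend_of_forall_ne fun j => (reg_ne _ _ (tmem _ _ _ le_rfl (lt j))).symm,
      extend_of_forall_ne fun j => A.tree_ne_row _ _ _ _ _ le_rfl (lt j) (lt ⟨i, hi⟩),
      clean _ _ _ le_rfl (lt ⟨i, hi⟩), hu, hw ⟨i, hi⟩]
    simp
  have clean3 : ∀ a j v, j ≤ h → v < 2 ^ j → (a = 2 ∨ j ≠ h) → b3 (A.T a j v) = false := by
    intro a j v hj hv h'
    have key : ∀ a', (a' : Fin 3) ≠ 2 → ∀ i : Fin K, A.T a' h i ≠ A.T a j v := by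
      intro a' ha' i h''
      have := A.isTree _ _ _ _ _ _ le_rfl (lt i) hj hv h''
      grind
    rw [hb3, extend_of_forall_ne (key 1 (by decide)), hb2,
      extend_of_forall_ne (key 1 (by decide)), hb1, extend_of_forall_ne (key 0 (by decide))]
    exact clean a j v hj hv
  have hC : ∀ i : Fin K, f b3 (A.T 2 h i) = BitVec.carry i u w false := by
    intro i
    rw [hfb b3 (fun a j hj v hv => clean3 a j v hj.le hv (by omega))
      (fun v hv => clean3 2 h v le_rfl hv (by simp)) i (lt i), ← prefixCarry_eq_carry]
    exact prefixCarry_congr (fun j hj => g3 j (by omega)) fun j hj => p3 j (by omega)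
  have hZ : ∀ i : Fin K, f b3 (A.R 2 i) = b (A.R 2 i) := fun i => hcomp.apply_of_notMem b (outS i)
  change extend (fun i : Fin K => A.R 2 i)
    (fun i => f b3 (A.R 2 i) ^^ f b3 (A.T 2 h i)) (f b3) = _
  simp only [hC, hZ]

/-- Adding the summand row to the register, in place. -/
lemma exists_addRow (A : AdderSpace h Q) (hK : K ≤ 2 ^ h) {reg : Fin K → Q}
    (hreg : Injective reg) (hregA : ∀ i, reg i ∉ A.qubits) :
    ∃ f, Realizable (A.qubits ∪ Set.range reg) (24 * h + 18) f ∧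
      ∀ (b : Q → Bool) (u w : BitVec K), (∀ q ∈ treeQubits A.T h, b q = false) →
        (∀ i : Fin K, b (A.R 2 i) = false) →
        (∀ i, b (reg i) = u.getLsbD i) → (∀ i : Fin K, b (A.R 1 i) = w.getLsbD i) →
        f b = extend reg (fun i => (u + w).getLsbD i) b := by
  have lt : ∀ i : Fin K, i.val < 2 ^ h := fun i => by omega
  have rmem : ∀ a i, i < 2 ^ h → A.R a i ∈ A.qubits := fun a i hi => Or.inr ⟨a, i, hi, rfl⟩
  have reg_ne : ∀ i q, q ∈ A.qubits → reg i ≠ q := fun i q hq h => hregA i (h ▸ hq)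
  have injR : ∀ a, Injective fun i : Fin K => A.R a i := fun a i j hij =>
    Fin.ext (A.row_inj _ _ _ _ (lt i) (lt j) hij).2
  have neR : ∀ a a' i i', a ≠ a' → i < 2 ^ h → i' < 2 ^ h → A.R a i ≠ A.R a' i' :=
    fun a a' i i' ha hi hi' h => ha (A.row_inj _ _ _ _ hi hi' h).1
  obtain ⟨f, hf, hfb⟩ := A.exists_xorCarry hK hreg hregA
  have row : ∀ a, Realizable (A.qubits ∪ Set.range reg) 1 fun b : Q → Bool =>
      extend reg (fun i => b (reg i) ^^ b (A.R a i)) b := fun a =>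
    Realizable.cnot_layer (fun i : Fin K => A.R a i) reg (injR a) hreg
      (fun i j => (reg_ne j _ (rmem _ _ (lt i))).symm) (fun i => Or.inl (rmem _ _ (lt i)))
      fun i => Or.inr ⟨i, rfl⟩
  have neg := Realizable.not_layer (S := A.qubits ∪ Set.range reg) reg hreg
    fun i => Or.inr ⟨i, rfl⟩
  -- after negation of the sum, the second use of `f` clears the carry row
  refine ⟨_, (((((hf.comp (row 1)).comp (row 2)).comp neg).comp hf).comp neg).mono le_rfl
    (by omega), ?_⟩
  intro b u w hT hZ hu hw
  -- the states that occur differ from `b` only in the carry row and in the register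
  let st : (Fin K → Bool) → (Fin K → Bool) → Q → Bool := fun z s =>
    extend (fun i : Fin K => A.R 2 i) z (extend reg s b)
  have hdis : ∀ (i : Fin K) j, A.R 2 i ≠ reg j := fun i j => (reg_ne j _ (rmem _ _ (lt i))).symm
  have st_row : ∀ z s (i : Fin K), st z s (A.R 2 i) = z i := fun z s i =>
    (injR 2).extend_apply _ _ i
  have st_reg : ∀ z s i, st z s (reg i) = s i := fun z s i => by
    simp only [st]
    rw [extend_of_forall_ne fun j => hdis j i, hreg.extend_apply]
  have st_summand : ∀ z s (i : Fin K), st z s (A.R 1 i) = w.getLsbD i := fun z s i => by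
    simp only [st]
    rw [extend_of_forall_ne fun j => neR _ _ _ _ (by decide) (lt j) (lt i),
      extend_of_forall_ne fun j => reg_ne j _ (rmem _ _ (lt i)), hw]
  have st_tree : ∀ z s, ∀ q ∈ treeQubits A.T h, st z s q = false := by
    rintro z s q ⟨a, j, v, hj, hv, rfl⟩
    simp only [st]
    rw [extend_of_forall_ne fun i => (A.tree_ne_row _ _ _ _ _ hj hv (lt i)).symm,
      extend_of_forall_ne fun i => reg_ne i _ (Or.inl ⟨a, j, v, hj, hv, rfl⟩),
      hT _ ⟨a, j, v, hj, hv, rfl⟩]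
  have set_row : ∀ z' z s, extend (fun i : Fin K => A.R 2 i) z' (st z s) = st z' s :=
    fun z' z s => extend_extend_same _ _ _ _
  have set_reg : ∀ s' z s, extend reg s' (st z s) = st z s' := fun s' z s => by
    simp only [st]
    rw [extend_extend_comm (fun i j => (hdis j i).symm), extend_extend_same]
  have h0 : b = st (fun _ => false) (fun i => u.getLsbD i) := by
    simp only [st]
    rw [extend_eq_self hreg (fun i => (hu i).symm), extend_eq_self (injR 2) fun i => (hZ i).symm]
  have hend : ∀ s, extend reg s b = st (fun _ => false) s := fun s => by
    rw [← set_reg s _ (fun i => u.getLsbD i), ← h0]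
  have hcarry : ∀ z (x : BitVec K), f (st z fun i => x.getLsbD i) =
      st (fun i => z i ^^ BitVec.carry i x w false) fun i => x.getLsbD i := fun z x => by
    rw [hfb _ x w (st_tree _ _) (fun i => st_reg _ _ i) (fun i => st_summand _ _ i), set_row]
    simp only [st_row]
  have hsum : ∀ i : Fin K, ((u.getLsbD i ^^ w.getLsbD i) ^^ BitVec.carry i u w false) =
      (u + w).getLsbD i := fun i => by
    rw [BitVec.getLsbD_add i.2, Bool.xor_assoc]
  have hnot : ∀ i : Fin K, (!(u + w).getLsbD i) = (~~~(u + w)).getLsbD i := fun i => by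
    simp
  rw [hend, h0]
  simp only [hcarry, st_reg, st_row, st_summand, set_reg, Bool.false_xor, hsum, hnot,
    carry_not_add u w (Fin.is_lt _).le, Bool.xor_self]
  simp

/-- Copying a control bit to a row, by repeated doubling. -/
lemma exists_fanOut (A : AdderSpace h Q) {y : Q} (hy : y ∉ A.qubits) {ℓ : ℕ} (hℓ : ℓ ≤ h) :
    ∃ f, Realizable (insert y {q | ∃ i < 2 ^ ℓ, q = A.R 0 i}) (ℓ + 1) f ∧
      ∀ b : Q → Bool, (∀ i < 2 ^ ℓ, b (A.R 0 i) = false) → ∀ i < 2 ^ ℓ, f b (A.R 0 i) = b y := by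
  have hpow : ∀ {k i : ℕ}, k ≤ h → i < 2 ^ k → i < 2 ^ h := fun hk hi =>
    hi.trans_le (Nat.pow_le_pow_right (by omega) hk)
  have hyne : ∀ i < 2 ^ h, y ≠ A.R 0 i := fun i hi h' => hy (h' ▸ Or.inr ⟨0, i, hi, rfl⟩)
  induction ℓ with
  | zero =>
    refine ⟨_, Realizable.cnot_gate y (A.R 0 0) (hyne 0 (by positivity)) (by simp) (by simp), ?_⟩
    intro b hb i hi
    obtain rfl : i = 0 := by simpa using hi
    simp [hb 0 (by simp)]
  | succ ℓ ih =>
    obtain ⟨f, hf, hfb⟩ := ih (by omega)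
    have e : 2 ^ (ℓ + 1) = 2 ^ ℓ + 2 ^ ℓ := by ring
    have lo : ∀ i : Fin (2 ^ ℓ), i.val < 2 ^ h := fun i => hpow (by omega : ℓ ≤ h) i.2
    have hi : ∀ i : Fin (2 ^ ℓ), i.val + 2 ^ ℓ < 2 ^ h := fun i => hpow hℓ (by omega)
    have inj : Injective fun i : Fin (2 ^ ℓ) => A.R 0 (i + 2 ^ ℓ) := fun i j hij =>
      Fin.ext (by have := (A.row_inj _ _ _ _ (hi i) (hi j) hij).2; omega)
    have layer := Realizable.cnot_layer (S := insert y {q | ∃ i < 2 ^ (ℓ + 1), q = A.R 0 i})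
      (fun i : Fin (2 ^ ℓ) => A.R 0 i) (fun i : Fin (2 ^ ℓ) => A.R 0 (i + 2 ^ ℓ))
      (fun i j hij => Fin.ext (A.row_inj _ _ _ _ (lo i) (lo j) hij).2) inj
      (fun i j hij => by have := (A.row_inj _ _ _ _ (lo i) (hi j) hij).2; omega)
      (fun i => Or.inr ⟨i, by omega, rfl⟩) (fun i => Or.inr ⟨i + 2 ^ ℓ, by omega, rfl⟩)
    refine ⟨_, (hf.mono (Set.insert_subset_insert ?_) le_rfl).comp layer, ?_⟩
    · rintro q ⟨i, hi, rfl⟩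
      exact ⟨i, by omega, rfl⟩
    intro b hb i hi'
    have old := hfb b fun i hi => hb i (by omega)
    by_cases h' : i < 2 ^ ℓ
    · rw [extend_of_forall_ne fun j hij => ?_, old i h']
      have := (A.row_inj _ _ _ _ (hi j) (hpow hℓ hi') hij).2
      omega
    · obtain ⟨j, rfl⟩ : ∃ j, i = j + 2 ^ ℓ := ⟨i - 2 ^ ℓ, by omega⟩
      rw [inj.extend_apply _ _ ⟨j, by omega⟩]
      simp only
      rw [old j (by omega), hf.apply_of_notMem b, hb _ hi', Bool.false_xor]
      rintro (h1 | ⟨k, hk, h1⟩)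
      · exact hyne _ (hpow hℓ hi') h1.symm
      · have := (A.row_inj _ _ _ _ (hpow hℓ hi') (hpow (by omega : ℓ ≤ h) hk) h1).2
        omega

/-- Adding the constant `w` to the register, in place, under the control of a qubit. -/
lemma exists_condAdd (A : AdderSpace h Q) (hK : K ≤ 2 ^ h) {reg : Fin K → Q}
    (hreg : Injective reg) (hregA : ∀ i, reg i ∉ A.qubits) {y : Q} (hy : y ∉ A.qubits)
    (hyreg : ∀ i, reg i ≠ y) (w : BitVec K) :
    ∃ f, Realizable (insert y (A.qubits ∪ Set.range reg)) (26 * h + 22) f ∧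
      ∀ (b : Q → Bool) (u : BitVec K), (∀ q ∈ A.qubits, b q = false) →
        (∀ i, b (reg i) = u.getLsbD i) →
        f b = extend reg (fun i => (u + if b y then w else 0).getLsbD i) b := by
  have lt : ∀ i : Fin K, i.val < 2 ^ h := fun i => by omega
  have rmem : ∀ a i, i < 2 ^ h → A.R a i ∈ A.qubits := fun a i hi => Or.inr ⟨a, i, hi, rfl⟩
  have reg_ne : ∀ i q, q ∈ A.qubits → reg i ≠ q := fun i q hq h => hregA i (h ▸ hq)
  have neR : ∀ a a' i i', a ≠ a' → i < 2 ^ h → i' < 2 ^ h → A.R a i ≠ A.R a' i' :=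
    fun a a' i i' ha hi hi' h => ha (A.row_inj _ _ _ _ hi hi' h).1
  have injR : ∀ a, Injective fun i : {i : Fin K // w.getLsbD i} => A.R a i := fun a i j hij =>
    Subtype.ext (Fin.ext (A.row_inj _ _ _ _ (lt i) (lt j) hij).2)
  set S : Set Q := insert y {q | ∃ a i, a ≠ 2 ∧ i < 2 ^ h ∧ q = A.R a i} with hS
  obtain ⟨f, hf, hfb⟩ := A.exists_fanOut hy le_rfl
  have hf' := hf.mono (S' := S) (Set.insert_subset_insert (by
    rintro q ⟨i, hi, rfl⟩
    exact ⟨0, i, by decide, hi, rfl⟩)) le_rfl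
  -- the summand row receives the control bit where `w` has a one
  have mask := Realizable.cnot_layer (S := S) (fun i : {i : Fin K // w.getLsbD i} => A.R 0 i)
    (fun i => A.R 1 i) (injR 0) (injR 1) (fun i j => neR _ _ _ _ (by decide) (lt i) (lt j))
    (fun i => Or.inr ⟨0, i, by decide, lt i, rfl⟩) (fun i => Or.inr ⟨1, i, by decide, lt i, rfl⟩)
  have hcomp := hf'.comp mask
  obtain ⟨g, hg, hgb⟩ := A.exists_addRow hK hreg hregA
  have outS : ∀ i, reg i ∉ S := by
    rintro i (h1 | ⟨a, j, -, hj, h1⟩)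
    exacts [hyreg i h1, reg_ne i _ (rmem _ _ hj) h1]
  have hsub : S ⊆ insert y (A.qubits ∪ Set.range reg) := by
    apply Set.insert_subset_insert
    rintro q ⟨a, i, -, hi, rfl⟩
    exact Or.inl (rmem _ _ hi)
  obtain ⟨F, hF, hFb⟩ := hcomp.exists_conj
    (hg.mono (Set.subset_insert y _) le_rfl) outS hsub
  refine ⟨F, hF.mono le_rfl (by omega), fun b u hclean hu => hFb b _ ?_⟩
  have out : ∀ q ∉ S, extend (fun i : {i : Fin K // w.getLsbD i} => A.R 1 i)
      (fun i => f b (A.R 1 i) ^^ f b (A.R 0 i)) (f b) q = b q := fun q hq =>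
    hcomp.apply_of_notMem b hq
  apply hgb
  · rintro q ⟨a, j, v, hj, hv, rfl⟩
    rw [out, hclean _ (Or.inl ⟨a, j, v, hj, hv, rfl⟩)]
    rintro (h1 | ⟨a', i, -, hi, h1⟩)
    exacts [hy (h1 ▸ Or.inl ⟨a, j, v, hj, hv, rfl⟩), A.tree_ne_row _ _ _ _ _ hj hv hi h1]
  · intro i
    rw [out, hclean _ (rmem _ _ (lt i))]
    rintro (h1 | ⟨a', j, ha, hj, h1⟩)
    exacts [hy (h1 ▸ rmem _ _ (lt i)), neR _ _ _ _ (Ne.symm ha) (lt i) hj h1]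
  · intro i
    rw [out _ (outS i), hu]
  · intro i
    have h1 : f b (A.R 1 i) = false := by
      rw [hf.apply_of_notMem, hclean _ (rmem _ _ (lt i))]
      rintro (h1 | ⟨j, hj, h1⟩)
      exacts [hy (h1 ▸ rmem _ _ (lt i)), neR _ _ _ _ (by decide) (lt i) hj h1]
    have h0 : f b (A.R 0 i) = b y := hfb b (fun j hj => hclean _ (rmem _ _ hj)) i (lt i)
    by_cases hw : w.getLsbD i
    · rw [(injR 1).extend_apply _ _ ⟨i, hw⟩]
      simp only
      rw [h1, h0]
      cases b y <;> simp [hw]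
    · rw [extend_of_forall_ne, h1]
      · rw [Bool.not_eq_true] at hw
        split <;> simp only [hw, BitVec.getLsbD_zero, BitVec.ofNat_eq_ofNat]
      · rintro ⟨j, hj⟩ h'
        obtain rfl : j = i := Fin.ext (A.row_inj _ _ _ _ (lt j) (lt i) h').2
        exact hw hj

end AdderSpace

/-! ### Controlled sums of constants and comparisons -/

/-- The work qubits of an adder together with a chain of `L + 1` qubits for conjunctions. -/
structure Workspace (h L : ℕ) (Q : Type) extends AdderSpace h Q where
  E : ℕ → Q
  chain_inj : ∀ i j, i ≤ L → j ≤ L → E i = E j → i = j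
  chain_notMem : ∀ i ≤ L, E i ∉ toAdderSpace.qubits

/-- All the work qubits. -/
def Workspace.allQubits {h L : ℕ} {Q : Type} (A : Workspace h L Q) : Set Q :=
  A.qubits ∪ {q | ∃ i ≤ L, q = A.E i}

section

variable {Q : Type} [DecidableEq Q]

/-- Place `i + 1` of the chain receives the conjunction of place `i` and the `i`-th bit of the
list. -/
lemma exists_andChainFrom (l : List Q) (E : ℕ → Q)
    (hE : ∀ i j, i ≤ l.length → j ≤ l.length → E i = E j → i = j)
    (hl : ∀ q ∈ l, ∀ i ≤ l.length, q ≠ E i) :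
    ∃ f, Realizable ({q | q ∈ l} ∪ {q | ∃ i ≤ l.length, q = E i}) l.length f ∧
      ∀ b : Q → Bool, (∀ i, 1 ≤ i → i ≤ l.length → b (E i) = false) →
        f b (E l.length) = (b (E 0) && l.all b) := by
  induction l generalizing E with
  | nil => exact ⟨_, Realizable.id.mono (Set.empty_subset _) le_rfl, fun b _ => by simp⟩
  | cons q l ih =>
    rw [List.length_cons] at hE hl
    obtain ⟨f, hf, hfb⟩ := ih (fun i => E (i + 1))
      (fun i j hi hj hij => by have := hE _ _ (by omega) (by omega) hij; omega)
      (fun r hr i hi => hl r (by simp [hr]) _ (by omega))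
    have gate := Realizable.toffoli_gate
      (S := {r | r ∈ q :: l} ∪ {r | ∃ i ≤ (q :: l).length, r = E i}) q (E 0) (E 1)
      (hl q (by simp) _ (by omega)) (hl q (by simp) _ (by omega))
      (fun h => by have := hE _ _ (by omega) (by omega) h; omega)
      (Or.inl (by simp)) (Or.inr ⟨0, by simp, rfl⟩) (Or.inr ⟨1, by simp, rfl⟩)
    refine ⟨_, (gate.comp (hf.mono ?_ le_rfl)).mono le_rfl
      (by rw [List.length_cons]; omega), ?_⟩
    · rintro r (hr | ⟨i, hi, rfl⟩)
      · exact Or.inl (by simp only [Set.mem_ofPred_eq] at hr ⊢; simp [hr])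
      · exact Or.inr ⟨i + 1, by rw [List.length_cons]; omega, rfl⟩
    · intro b hb
      rw [List.length_cons] at hb ⊢
      have hall : l.all (update b (E 1) (b (E 1) ^^ (b q && b (E 0)))) = l.all b := by
        rw [Bool.eq_iff_iff, List.all_eq_true, List.all_eq_true]
        refine forall₂_congr fun r hr => ?_
        rw [update_of_ne (hl r (by simp [hr]) _ (by omega))]
      rw [hfb _ fun i h1 h2 => ?_, zero_add, hall, update_self, hb 1 le_rfl (by omega)]
      · simp only [List.all_cons, Bool.false_xor]
        cases b q <;> cases b (E 0) <;> rfl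
      · rw [update_of_ne fun h => ?_, hb _ (by omega) (by omega)]
        have := hE _ _ (by omega) (by omega) h
        omega

/-- Acting in turn on blocks of qubits, such that each action overwrites its block with values that
depend on the initial state alone. -/
lemma Realizable.exists_blocks {J ι X : Type} [Fintype J] {S : Set Q} {d : ℕ} (t : J → ι → Q)
    (ht : Injective (uncurry t)) (b₀ : X → Q → Bool) (v : J → X → ι → Bool)
    (step : ∀ j, ∃ f, Realizable S d f ∧ ∀ x, ∀ b : Q → Bool,
      (∀ q, (∀ i ≠ j, ∀ y, t i y ≠ q) → b q = b₀ x q) → f b = extend (t j) (v j x) b) :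
    ∃ f, Realizable S (Fintype.card J * d) f ∧
      ∀ x, f (b₀ x) = extend (uncurry t) (fun p => v p.1 x p.2) (b₀ x) := by
  have key : ∀ l : List J, l.Nodup → ∃ f, Realizable S (l.length * d) f ∧ ∀ x,
      (∀ j ∈ l, ∀ y, f (b₀ x) (t j y) = v j x y) ∧
      ∀ q, (∀ j ∈ l, ∀ y, t j y ≠ q) → f (b₀ x) q = b₀ x q := by
    intro l
    induction l with
    | nil => exact fun _ => ⟨_, Realizable.id.mono (Set.empty_subset _) (by simp), by simp⟩
    | cons j l ih =>
      intro hl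
      obtain ⟨hjl, hl⟩ := List.nodup_cons.1 hl
      obtain ⟨f, hf, hfb⟩ := ih hl
      obtain ⟨g, hg, hgb⟩ := step j
      refine ⟨_, (hf.comp hg).mono le_rfl (by simp [add_mul]), fun x => ?_⟩
      obtain ⟨h1, h2⟩ := hfb x
      have hgf := hgb x (f (b₀ x)) fun q hq => h2 q fun i hi y =>
        hq i (fun h => hjl (h ▸ hi)) y
      have htj : Injective (t j) := fun y z hyz => by
        have := @ht (j, y) (j, z) hyz
        simpa using this
      simp only [hgf]
      constructor
      · intro i hi y
        by_cases hij : i = j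
        · subst hij
          rw [htj.extend_apply]
        · rw [extend_of_forall_ne fun z hz => hij ?_, h1 i ((List.mem_cons.1 hi).resolve_left hij)]
          have := @ht (j, z) (i, y) hz
          simp_all
      · intro q hq
        rw [extend_of_forall_ne (hq j (by simp)), h2 q fun i hi => hq i (by simp [hi])]
  obtain ⟨f, hf, hfb⟩ := key _ (Finset.nodup_toList (Finset.univ : Finset J))
  refine ⟨f, hf.mono le_rfl (by simp), fun x => ?_⟩
  obtain ⟨h1, h2⟩ := hfb x
  ext q
  by_cases hq : ∃ p, uncurry t p = q
  · obtain ⟨p, rfl⟩ := hq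
    rw [ht.extend_apply]
    exact h1 p.1 (by simp) p.2
  · rw [extend_apply' _ _ _ hq]
    exact h2 q fun j _ y h => hq ⟨(j, y), h⟩

namespace Workspace

variable {h L K : ℕ}

/-- The conjunction of the bits in a list is computed at the corresponding place of the chain. -/
lemma exists_andChain (A : Workspace h L Q) {l : List Q} (hlL : l.length ≤ L)
    (hl : ∀ q ∈ l, q ∉ A.allQubits) :
    ∃ f, Realizable ({q | q ∈ l} ∪ {q | ∃ i ≤ L, q = A.E i}) (l.length + 1) f ∧
      ∀ b : Q → Bool, (∀ i ≤ L, b (A.E i) = false) → f b (A.E l.length) = l.all b := by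
  have hne : ∀ q ∈ l, ∀ i ≤ L, q ≠ A.E i := fun q hq i hi h => hl q hq (Or.inr ⟨i, hi, h⟩)
  obtain ⟨f, hf, hfb⟩ := exists_andChainFrom l A.E
    (fun i j hi hj => A.chain_inj i j (by omega) (by omega)) fun q hq i hi => hne q hq i (by omega)
  have gate := Realizable.not_gate (S := {q | q ∈ l} ∪ {q | ∃ i ≤ L, q = A.E i}) (A.E 0)
    (Or.inr ⟨0, by omega, rfl⟩)
  refine ⟨_, (gate.comp (hf.mono ?_ le_rfl)).mono le_rfl (by omega), ?_⟩
  · rintro q (hq | ⟨i, hi, rfl⟩)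
    exacts [Or.inl hq, Or.inr ⟨i, by omega, rfl⟩]
  · intro b hb
    have hall : l.all (update b (A.E 0) (!b (A.E 0))) = l.all b := by
      rw [Bool.eq_iff_iff, List.all_eq_true, List.all_eq_true]
      refine forall₂_congr fun r hr => ?_
      rw [update_of_ne (hne r hr _ (by omega))]
    rw [hfb _ fun i h1 h2 => ?_, hall, update_self, hb 0 (by omega)]
    · simp
    · rw [update_of_ne fun h => ?_, hb _ (by omega)]
      have := A.chain_inj _ _ (by omega) (by omega) h
      omega

/-- Adding the conjunction of the bits in a list to a bit. -/
lemma exists_andInto (A : Workspace h L Q) {l : List Q} (hlL : l.length ≤ L)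
    (hl : ∀ q ∈ l, q ∉ A.allQubits) {y : Q} (hy : y ∉ A.allQubits) (hyl : y ∉ l) {S : Set Q}
    (hAS : A.allQubits ⊆ S) (hlS : ∀ q ∈ l, q ∈ S) (hyS : y ∈ S) :
    ∃ f, Realizable S (2 * l.length + 3) f ∧
      ∀ b : Q → Bool, (∀ q ∈ A.allQubits, b q = false) → f b = update b y (b y ^^ l.all b) := by
  obtain ⟨f, hf, hfb⟩ := A.exists_andChain hlL hl
  have hE : ∀ i ≤ L, A.E i ∈ A.allQubits := fun i hi => Or.inr ⟨i, hi, rfl⟩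
  have gate := Realizable.cnot_gate (S := S) (A.E l.length) y (fun h => hy (h ▸ hE _ hlL))
    (hAS (hE _ hlL)) hyS
  have hout : y ∉ {q | q ∈ l} ∪ {q | ∃ i ≤ L, q = A.E i} := by
    rintro (h1 | ⟨i, hi, h1⟩)
    exacts [hyl h1, hy (h1 ▸ hE i hi)]
  obtain ⟨g, hg, hgb⟩ := hf.exists_conj (t := fun _ : Unit => y) gate (fun _ => hout) (by
    rintro q (hq | ⟨i, hi, rfl⟩)
    exacts [hlS q hq, hAS (hE i hi)])
  refine ⟨g, hg.mono le_rfl (by omega), fun b hb => ?_⟩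
  rw [hgb b (fun _ => b y ^^ l.all b), extend_unit]
  simp only [extend_unit]
  rw [hf.apply_of_notMem b hout, hfb b fun i hi => hb _ (hE i hi)]

/-- Adding constants to a register, each under the control of the conjunction of a list of bits. -/
lemma exists_batchAdd (A : Workspace h L Q) (hK : K ≤ 2 ^ h) {reg : Fin K → Q}
    (hreg : Injective reg) (hregA : ∀ i, reg i ∉ A.allQubits) {S : Set Q}
    (hAS : A.allQubits ⊆ S) (hregS : ∀ i, reg i ∈ S) {c : ℕ} (hcL : c ≤ L)
    (l : List (List Q × BitVec K)) (hlc : ∀ p ∈ l, p.1.length ≤ c)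
    (hlA : ∀ p ∈ l, ∀ q ∈ p.1, q ∉ A.allQubits) (hlreg : ∀ p ∈ l, ∀ q ∈ p.1, ∀ i, reg i ≠ q)
    (hlS : ∀ p ∈ l, ∀ q ∈ p.1, q ∈ S) :
    ∃ f, Realizable S (l.length * (2 * (c + 1) + (26 * h + 22))) f ∧
      ∀ (b : Q → Bool) (u : BitVec K), (∀ q ∈ A.allQubits, b q = false) →
        (∀ i, b (reg i) = u.getLsbD i) →
        f b = extend reg
          (fun i => (u + (l.map fun p => if p.1.all b then p.2 else 0).sum).getLsbD i) b := by
  have hE : ∀ i ≤ L, A.E i ∈ A.allQubits := fun i hi => Or.inr ⟨i, hi, rfl⟩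
  induction l with
  | nil =>
    refine ⟨_, Realizable.id.mono (Set.empty_subset _) (by simp), fun b u _ hu => ?_⟩
    rw [extend_eq_self hreg]
    simp [hu]
  | cons p l ih =>
    obtain ⟨f, hf, hfb⟩ := ih (fun p hp => hlc p (by simp [hp])) (fun p hp => hlA p (by simp [hp]))
      (fun p hp => hlreg p (by simp [hp])) (fun p hp => hlS p (by simp [hp]))
    have hpL : p.1.length ≤ L := (hlc p (by simp)).trans hcL
    obtain ⟨g, hg, hgb⟩ := A.exists_andChain hpL (hlA p (by simp))
    obtain ⟨k, hk, hkb⟩ := A.exists_condAdd hK hreg (fun i hi => hregA i (Or.inl hi))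
      (A.chain_notMem _ hpL) (fun i hi => hregA i (hi ▸ hE _ hpL)) p.2
    have hout : ∀ i, reg i ∉ {q | q ∈ p.1} ∪ {q | ∃ i ≤ L, q = A.E i} := by
      rintro i (h1 | ⟨j, hj, h1⟩)
      exacts [hlreg p (by simp) _ h1 i rfl, hregA i (h1 ▸ hE j hj)]
    have houtA : ∀ q ∈ A.qubits, q ∉ {q | q ∈ p.1} ∪ {q | ∃ i ≤ L, q = A.E i} := by
      rintro q hq (h1 | ⟨j, hj, h1⟩)
      exacts [hlA p (by simp) q h1 (Or.inl hq), A.chain_notMem j hj (h1 ▸ hq)]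
    have hkS : insert (A.E p.1.length) (A.qubits ∪ Set.range reg) ⊆ S := by
      rintro q (rfl | hq | ⟨i, rfl⟩)
      exacts [hAS (hE _ hpL), hAS (Or.inl hq), hregS i]
    have hgS : {q | q ∈ p.1} ∪ {q | ∃ i ≤ L, q = A.E i} ⊆ S := by
      rintro q (hq | ⟨i, hi, rfl⟩)
      exacts [hlS p (by simp) q hq, hAS (hE i hi)]
    obtain ⟨F, hF, hFb⟩ := hg.exists_conj (t := reg) (hk.mono hkS le_rfl) hout hgS
    refine ⟨_, (hF.comp hf).mono le_rfl ?_, fun b u hb hu => ?_⟩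
    · rw [List.length_cons, add_mul, add_comm (l.length * _)]
      have := hlc p (by simp)
      gcongr
      omega
    · have h1 : F b = extend reg
          (fun i => (u + if p.1.all b then p.2 else 0).getLsbD i) b := by
        apply hFb
        rw [hkb (g b) u, hgb b fun i hi => hb _ (hE i hi)]
        · intro q hq
          rw [hg.apply_of_notMem b (houtA q hq), hb q (Or.inl hq)]
        · intro i
          rw [hg.apply_of_notMem b (hout i), hu]
      have hall : ∀ p' ∈ l, p'.1.all (F b) = p'.1.all b := by
        intro p' hp'
        rw [Bool.eq_iff_iff, List.all_eq_true, List.all_eq_true]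
        refine forall₂_congr fun r hr => ?_
        rw [h1, extend_of_forall_ne (hlreg p' (by simp [hp']) r hr)]
      have hmap : (l.map fun p' => if p'.1.all (F b) then p'.2 else 0) =
          l.map fun p' => if p'.1.all b then p'.2 else 0 :=
        List.map_congr_left fun p' hp' => by rw [hall p' hp']
      rw [hfb (F b) (u + if p.1.all b then p.2 else 0), hmap, h1, extend_extend_same,
        List.map_cons, List.sum_cons, add_assoc]
      · intro q hq
        rw [h1, extend_of_forall_ne fun i (hi : reg i = q) => hregA i (hi ▸ hq), hb q hq]
      · intro i
        rw [h1, hreg.extend_apply]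

/-- Testing the sign of the sum of the content of the register `r`, as a natural number, and of
controlled constants. The sum is formed in the scratch register `R`. -/
lemma exists_signTest (A : Workspace h L Q) (hK : K ≤ 2 ^ h) {κ : ℕ} (hκ : κ < K)
    {r : Fin κ → Q} (hr : Injective r) {R : Fin K → Q} (hR : Injective R)
    (hRA : ∀ i, R i ∉ A.allQubits) (hrR : ∀ i j, r i ≠ R j)
    {y : Q} (hyA : y ∉ A.allQubits) (hyr : ∀ i, r i ≠ y) (hyR : ∀ i, R i ≠ y) {S : Set Q}
    (hAS : A.allQubits ⊆ S) (hrS : ∀ i, r i ∈ S) (hRS : ∀ i, R i ∈ S) (hyS : y ∈ S)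
    {c : ℕ} (hcL : c ≤ L)
    (l : List (List Q × BitVec K)) (hlc : ∀ p ∈ l, p.1.length ≤ c)
    (hlA : ∀ p ∈ l, ∀ q ∈ p.1, q ∉ A.allQubits) (hlR : ∀ p ∈ l, ∀ q ∈ p.1, ∀ i, R i ≠ q)
    (hly : ∀ p ∈ l, ∀ q ∈ p.1, q ≠ y) (hlS : ∀ p ∈ l, ∀ q ∈ p.1, q ∈ S) :
    ∃ f, Realizable S (2 * (1 + l.length * (2 * (c + 1) + (26 * h + 22))) + 2) f ∧
      ∀ (b : Q → Bool) (u : BitVec κ), (∀ q ∈ A.allQubits, b q = false) →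
        (∀ i, b (R i) = false) → (∀ i, b (r i) = u.getLsbD i) → b y = false →
        f b = update b y
          (!(u.setWidth K + (l.map fun p => if p.1.all b then p.2 else 0).sum).msb) := by
  have hSy : ∀ {q}, q ∈ S → q ≠ y → q ∈ S \ {y} := fun h1 h2 => ⟨h1, h2⟩
  have hRinj : Injective fun i : Fin κ => R (i.castLE hκ.le) :=
    hR.comp (Fin.castLE_injective hκ.le)
  have copy := Realizable.cnot_layer (S := S \ {y}) r (fun i : Fin κ => R (i.castLE hκ.le)) hr
    hRinj (fun i j => hrR i _) (fun i => hSy (hrS i) (hyr i)) fun i => hSy (hRS _) (hyR _)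
  obtain ⟨f, hf, hfb⟩ := A.exists_batchAdd (S := S \ {y}) hK hR hRA
    (fun q hq => hSy (hAS hq) fun h => hyA (h ▸ hq)) (fun i => hSy (hRS i) (hyR i)) hcL l hlc hlA
    hlR fun p hp q hq => hSy (hlS p hp q hq) (hly p hp q hq)
  have top : K - 1 < K := by omega
  have test := (Realizable.cnot_gate (S := S) (R ⟨K - 1, top⟩) y (hyR _) (hRS _) hyS).comp
    (Realizable.not_gate y hyS)
  have hcomp := copy.comp hf
  obtain ⟨F, hF, hFb⟩ := hcomp.exists_conj (t := fun _ : Unit => y) test (by simp) Set.sdiff_subset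
  refine ⟨F, hF.mono le_rfl (by omega), fun b u hb hbR hbr hby => ?_⟩
  rw [hFb b fun _ => !(u.setWidth K + (l.map fun p => if p.1.all b then p.2 else 0).sum).msb,
    extend_unit]
  have hy : f (extend (fun i : Fin κ => R (i.castLE hκ.le))
      (fun i => b (R (i.castLE hκ.le)) ^^ b (r i)) b) y = false :=
    (hcomp.apply_of_notMem b (by simp)).trans hby
  -- the state after the register has been copied to the scratch register
  set b1 := extend (fun i : Fin κ => R (i.castLE hκ.le))
    (fun i => b (R (i.castLE hκ.le)) ^^ b (r i)) b with hb1
  have hb1out : ∀ q, (∀ i, R i ≠ q) → b1 q = b q := fun q hq => extend_of_forall_ne fun i => hq _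
  have hmap : (l.map fun p => if p.1.all b1 then p.2 else 0) =
      l.map fun p => if p.1.all b then p.2 else 0 := by
    refine List.map_congr_left fun p hp => ?_
    have : p.1.all b1 = p.1.all b := by
      rw [Bool.eq_iff_iff, List.all_eq_true, List.all_eq_true]
      refine forall₂_congr fun q hq => ?_
      rw [hb1out q (hlR p hp q hq)]
    rw [this]
  have htop : f b1 (R ⟨K - 1, top⟩) =
      (u.setWidth K + (l.map fun p => if p.1.all b then p.2 else 0).sum).msb := by
    rw [hfb b1 (u.setWidth K), hR.extend_apply, hmap, BitVec.msb_eq_getLsbD_last]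
    · intro q hq
      rw [hb1out q fun i hi => hRA i (hi ▸ hq), hb q hq]
    · intro i
      rw [BitVec.getLsbD_setWidth, decide_eq_true i.2, Bool.true_and]
      by_cases hi : i.val < κ
      · rw [hb1]
        refine (hRinj.extend_apply _ _ ⟨i, hi⟩).trans ?_
        rw [hbR, hbr, Bool.false_xor]
      · rw [hb1, extend_of_forall_ne fun j hj => ?_, hbR, BitVec.getLsbD_of_ge _ _ (by omega)]
        have := congrArg Fin.val (hR hj)
        simp at this
        omega
  simp only [update_self, extend_unit, update_idem]
  rw [htop, hy, Bool.false_xor]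

end Workspace

end

/-! ### The oracle as a circuit -/

/-- A circuit that does not touch the qubit `q` commutes with every change of it. -/
lemma LocalOn.update_comm {Q : Type} [DecidableEq Q] {q : Q} {f : (Q → Bool) → Q → Bool}
    (hf : LocalOn {q}ᶜ f) (b : Q → Bool) (a : Bool) : f (update b q a) = update (f b) q a := by
  ext r
  by_cases hr : r = q
  · subst hr
    rw [hf.1 _ _ (by simp), update_self, update_self]
  · rw [update_of_ne hr]
    exact hf.2 _ _ (fun p hp => update_of_ne hp _ _) r hr

section Oracle

variable {n m κ a : ℕ}

lemma encode_injective : Injective (encode (n := n) (m := m) (κ := κ) a) := by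
  intro s s' h
  refine Prod.ext (funext fun i => congrFun h (.inl i)) (funext fun k => ?_)
  refine BitVec.eq_of_getLsbD_eq fun j hj => ?_
  exact congrFun h (.inr (.inl (k, ⟨j, hj⟩)))

lemma withAncillas_encode (ψ : RegState n m κ) (s : RegConfig n m κ) :
    withAncillas a ψ (encode a s) = ψ s :=
  encode_injective.extend_apply _ _ _

lemma withAncillas_of_notMem (ψ : RegState n m κ) {b : RegQubit n m κ a → Bool}
    (hb : ¬∃ s, encode a s = b) : withAncillas a ψ b = 0 :=
  extend_apply' _ _ _ hb

lemma update_encode (s : RegConfig n m κ) (t : Fin n) (x : Bool) :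
    update (encode a s) (.inl t) x = encode a (update s.1 t x, s.2) := by
  ext q
  rcases q with i | ⟨k, j⟩ | i
  · by_cases hi : i = t
    · subst hi
      simp [encode]
    · simp [encode, hi]
  · simp [encode]
  · simp [encode]

variable (I : SumConstraints n m)

/-- A classical circuit that computes the conditions on two qubits, away from the qubit `t`, and a
classical circuit for the subtractions combine to a circuit for the oracle. -/
lemma implements_oracle (θ : ℝ) (t : Fin n) {P D : QCircuit (RegQubit n m κ a)}
    {S : Set (RegQubit n m κ a)} (hP : P.ClassicalOn {.inl t}ᶜ) (hD : D.ClassicalOn S)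
    {y z : RegQubit n m κ a} (hy : y ≠ .inl t) (hz : z ≠ .inl t)
    (hPy : ∀ s, P.act (encode a s) y = true ↔ I.bPlus t s ∧ I.bMinus t s)
    (hPz : ∀ s, P.act (encode a s) z = true ↔ I.bPlus t s ∧ ¬ I.bMinus t s)
    (hDs : ∀ s, D.act (encode a s) =
      encode a (s.1, fun k => s.2 k - BitVec.ofInt κ (I.cost t s.1 k))) :
    Implements (P ++ ([⟨[.controlledRotY y (.inl t) hy θ], by simp⟩,
      ⟨[.cnot z (.inl t) hz], by simp⟩] ++ (P.inv ++ D))) (I.oracle θ t) := by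
  intro ψ
  simp only [QCircuit.run_append]
  set φ := QCircuit.run P (withAncillas a ψ) with hφ
  have hupd : ∀ b x, φ (update (P.act b) (.inl t) x) = withAncillas a ψ (update b (.inl t) x) := by
    intro b x
    rw [← hP.localOn.update_comm, hφ, QCircuit.run_act hP]
  have hbranch : QCircuit.run P.inv (QCircuit.run
      [⟨[.controlledRotY y (.inl t) hy θ], by simp⟩, ⟨[.cnot z (.inl t) hz], by simp⟩] φ) =
      withAncillas a (I.branch θ t ψ) := by
    ext b
    have h1 := QCircuit.run_act hP.inv (QCircuit.run
      [⟨[.controlledRotY y (.inl t) hy θ], by simp⟩, ⟨[.cnot z (.inl t) hz], by simp⟩] φ) (P.act b)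
    rw [QCircuit.act_inv_act] at h1
    rw [h1]
    have hb : P.act b (.inl t) = b (.inl t) := hP.localOn.1 b _ (by simp)
    simp only [QCircuit.run, List.foldl_cons, List.foldl_nil, QGate.apply, applyAt, update_self,
      update_idem, hupd, update_of_ne hy, hb]
    by_cases hr : ∃ s, encode a s = b
    · obtain ⟨s, rfl⟩ := hr
      have he : encode a s (.inl t) = s.1 t := rfl
      simp only [update_encode, withAncillas_encode, SumConstraints.branch,
        SumConstraints.branchGate, he]
      classical
      have hs : P.act (encode a s) y = decide (I.bPlus t s ∧ I.bMinus t s) := by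
        rw [Bool.eq_iff_iff, hPy, decide_eq_true_iff]
      have hs' : P.act (encode a s) z = decide (I.bPlus t s ∧ ¬ I.bMinus t s) := by
        rw [Bool.eq_iff_iff, hPz, decide_eq_true_iff]
      rw [hs, hs']
      by_cases h2 : I.bPlus t s <;> by_cases h3 : I.bMinus t s <;> cases s.1 t <;>
        simp [h2, h3, Matrix.one_apply, notX]
    · rw [withAncillas_of_notMem _ hr]
      have : ∀ x, withAncillas a ψ (update b (.inl t) x) = 0 := by
        intro x
        refine withAncillas_of_notMem _ ?_
        rintro ⟨s, hs⟩
        refine hr ⟨(update s.1 t (b (.inl t)), s.2), ?_⟩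
        rw [← update_encode, hs, update_idem, update_eq_self]
      simp [this]
  rw [hbranch]
  ext b
  -- the classical circuit permutes the states with clear ancillas
  obtain ⟨b', rfl⟩ : ∃ b', D.act b' = b := ⟨_, D.act_act_inv b⟩
  rw [QCircuit.run_act hD]
  by_cases hr : ∃ s, encode a s = b'
  · obtain ⟨s, rfl⟩ := hr
    rw [hDs, withAncillas_encode, withAncillas_encode, SumConstraints.oracle,
      SumConstraints.subtract]
    simp
  · rw [withAncillas_of_notMem _ hr, withAncillas_of_notMem]
    rintro ⟨s, hs⟩
    refine hr ⟨(s.1, fun k => s.2 k + BitVec.ofInt κ (I.cost t s.1 k)), ?_⟩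
    have h1 := hDs (s.1, fun k => s.2 k + BitVec.ofInt κ (I.cost t s.1 k))
    simp only [BitVec.add_sub_cancel] at h1
    have h2 := congrArg D.inv.act (h1.trans hs)
    rwa [QCircuit.act_inv_act, QCircuit.act_inv_act] at h2

end Oracle

/-! ### The costs as controlled sums -/

namespace SumConstraints

variable {n m : ℕ} (I : SumConstraints n m)

/-- The sets that contribute to the cost of `x_t = 1` (for `true`) or `x_t = 0` (for `false`). -/
def terms (t : Fin n) (k : Fin m) : Bool → Finset (Finset (Fin n))
  | true => {S | I.w S k ≠ 0 ∧ (t ∈ S ∧ ∀ j ∈ S, j ≤ t) ∧ 0 ≤ I.w S k}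
  | false => {S | I.w S k ≠ 0 ∧ I.w S k < 0 ∧ t ∈ S}

/-- The variables on which the contribution of a set to the cost depends. -/
def controls (t : Fin n) : Bool → Finset (Fin n) → Finset (Fin n)
  | true, S => S.erase t
  | false, S => {j ∈ S | j < t}

/-- The cost of `x_t = 1` or `x_t = 0`. -/
def costOf (t : Fin n) (x : Fin n → Bool) (k : Fin m) : Bool → ℤ
  | true => I.QPlus t x k
  | false => I.QMinus t x k

lemma cost_eq_costOf (t : Fin n) (x : Fin n → Bool) (k : Fin m) :
    I.cost t x k = I.costOf t x k (x t) := by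
  unfold cost
  cases x t <;> rfl

lemma notMem_controls (t : Fin n) (s : Bool) (S : Finset (Fin n)) : t ∉ controls t s S := by
  cases s <;> simp [controls]

lemma card_terms_le (t : Fin n) (k : Fin m) (s : Bool) :
    (I.terms t k s).card ≤ (Finset.univ.filter fun S : Finset (Fin n) => I.w S k ≠ 0).card := by
  refine Finset.card_le_card fun S => ?_
  cases s <;> simp +contextual [terms]

lemma prodVar_eq_ite (x : Fin n → Bool) (S : Finset (Fin n)) :
    prodVar x S = if ∀ j ∈ S, x j = true then 1 else 0 := by
  unfold prodVar
  split_ifs with h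
  · exact Finset.prod_eq_one fun j hj => by simp [h j hj]
  · push Not at h
    obtain ⟨j, hj, hx⟩ := h
    exact Finset.prod_eq_zero hj (by simp [Bool.eq_false_of_not_eq_true hx])

lemma costOf_eq_sum (t : Fin n) (x : Fin n → Bool) (k : Fin m) (s : Bool) :
    I.costOf t x k s =
      ∑ S ∈ I.terms t k s,
        if ∀ j ∈ controls t s S, x j = true then ((I.w S k).natAbs : ℤ) else 0 := by
  cases s
  all_goals
    simp only [costOf, QPlus, QMinus, terms, controls, prodVar_eq_ite, Finset.sum_filter]
    refine Finset.sum_congr rfl fun S _ => ?_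
    by_cases h : I.w S k = 0
    · simp [h]
    · simp [h]

end SumConstraints

/-- A sum of natural numbers may be compared with a `κ`-bit integer after capping the summands. -/
lemma sum_min_le_toInt_iff {ι : Type} (F : Finset ι) (P : ι → Prop) [DecidablePred P] (ω : ι → ℕ)
    {κ : ℕ} (u : BitVec κ) :
    (∑ i ∈ F, if P i then ((min (ω i) (2 ^ κ) : ℕ) : ℤ) else 0) ≤ u.toInt ↔
      (∑ i ∈ F, if P i then (ω i : ℤ) else 0) ≤ u.toInt := by
  have hu : u.toInt < 2 ^ κ := by
    have h1 := u.toInt_lt (w := κ)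
    have h2 : (2 : ℤ) ^ (κ - 1) ≤ 2 ^ κ := pow_le_pow_right₀ (by norm_num) (by omega)
    omega
  by_cases h : ∃ i ∈ F, P i ∧ 2 ^ κ ≤ ω i
  · obtain ⟨i, hi, hP, hω⟩ := h
    have h1 : (2 : ℤ) ^ κ ≤ ∑ i ∈ F, if P i then ((min (ω i) (2 ^ κ) : ℕ) : ℤ) else 0 := by
      refine le_trans ?_ (Finset.single_le_sum (fun j _ => ?_) hi)
      · simp only [hP, if_true, min_eq_right hω]
        norm_cast
      · split_ifs <;> positivity
    have h2 : (2 : ℤ) ^ κ ≤ ∑ i ∈ F, if P i then (ω i : ℤ) else 0 := by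
      refine le_trans ?_ (Finset.single_le_sum (fun j _ => ?_) hi)
      · simp only [hP, if_true]
        exact_mod_cast hω
      · split_ifs <;> positivity
    constructor <;> intro <;> omega
  · push Not at h
    rw [Finset.sum_congr rfl fun i hi => ?_]
    by_cases hP : P i
    · simp only [hP, if_true, min_eq_left (h i hi hP).le]
    · simp [hP]

lemma sum_map_ite_ofInt {α : Type} {K : ℕ} (l : List α) (c : α → Bool) (z : α → ℤ) :
    (l.map fun p => if c p then BitVec.ofInt K (z p) else 0).sum =
      BitVec.ofInt K (l.map fun p => if c p then z p else 0).sum := by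
  induction l with
  | nil => simp
  | cons p l ih =>
    rw [List.map_cons, List.map_cons, List.sum_cons, List.sum_cons, ih, BitVec.ofInt_add]
    cases c p <;> simp

/-- The sign bit that decides whether a controlled sum is at most the content of a register. The
bits of the register are read as a natural number, which `-2 ^ κ` corrects if the sign bit is set.
At most `2 ^ n` capped summands leave the difference in the range of `κ + n + 2` bits. -/
lemma msb_eq_false_iff_sum_le {n κ : ℕ} {α : Type} (F : Finset α) (hF : F.card ≤ 2 ^ n)
    (P : α → Prop) [DecidablePred P] (ω : α → ℕ) (u : BitVec κ) :
    (u.setWidth (κ + n + 2) + BitVec.ofInt (κ + n + 2) ((if u.msb then -2 ^ κ else 0) +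
      ∑ i ∈ F, if P i then -((min (ω i) (2 ^ κ) : ℕ) : ℤ) else 0)).msb = false ↔
      (∑ i ∈ F, if P i then (ω i : ℤ) else 0) ≤ u.toInt := by
  rw [← sum_min_le_toInt_iff]
  set s := ∑ i ∈ F, if P i then ((min (ω i) (2 ^ κ) : ℕ) : ℤ) else 0 with hs
  have hneg : (∑ i ∈ F, if P i then -((min (ω i) (2 ^ κ) : ℕ) : ℤ) else 0) = -s := by
    rw [hs, ← Finset.sum_neg_distrib]
    exact Finset.sum_congr rfl fun i _ => by split_ifs <;> simp
  have hs0 : 0 ≤ s := Finset.sum_nonneg fun i _ => by split_ifs <;> positivity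
  have hs1 : s ≤ 2 ^ (κ + n) := by
    calc s ≤ ∑ i ∈ F, (2 : ℤ) ^ κ := Finset.sum_le_sum fun i _ => by
            split_ifs
            · exact_mod_cast min_le_right _ _
            · positivity
      _ = F.card * 2 ^ κ := by rw [Finset.sum_const, nsmul_eq_mul]
      _ ≤ 2 ^ n * 2 ^ κ := by
            gcongr
            exact_mod_cast hF
      _ = 2 ^ (κ + n) := by rw [pow_add]; ring
  have hu : u.setWidth (κ + n + 2) = BitVec.ofInt (κ + n + 2) (u.toNat : ℤ) := by
    apply BitVec.eq_of_toNat_eq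
    simp
  rw [hneg, hu, ← BitVec.ofInt_add]
  have hval : (u.toNat : ℤ) + ((if u.msb then -2 ^ κ else 0) + -s) = u.toInt - s := by
    rw [BitVec.toInt_eq_msb_cond]
    split_ifs
    · push_cast; ring
    · ring
  have h1 := u.toInt_lt
  have h2 := u.le_toInt
  have e1 : (2 : ℤ) ^ (κ - 1) ≤ 2 ^ (κ + n) := pow_le_pow_right₀ (by norm_num) (by omega)
  have e2 : (2 : ℤ) ^ (κ + n + 2 - 1) = 2 * 2 ^ (κ + n) := by
    rw [show κ + n + 2 - 1 = κ + n + 1 by omega, pow_succ]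
    ring
  rw [hval, BitVec.msb_eq_toInt, BitVec.toInt_ofInt_eq_self (by omega) (by omega) (by omega)]
  rw [decide_eq_false_iff_not]
  omega

/-! ### Allocation of the ancillas -/

/-- Labels of the work qubits of `Workspace h L`. -/
abbrev WorkIndex (h L : ℕ) := (Fin 3 × Fin (2 ^ (h + 1))) ⊕ (Fin 3 × Fin (2 ^ h)) ⊕ Fin (L + 1)

/-- A workspace on distinct qubits with the given labels. Node `v` at level `ℓ` of the tree has the
number `2 ^ ℓ + v`; out of range, the indices wrap around. -/
def Workspace.ofInjective {h L : ℕ} {Q : Type} (w : WorkIndex h L → Q) (hw : Injective w) :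
    Workspace h L Q where
  T a ℓ v := w (.inl (a, Fin.ofNat _ (2 ^ ℓ + v)))
  R a i := w (.inr (.inl (a, Fin.ofNat _ i)))
  E i := w (.inr (.inr (Fin.ofNat _ i)))
  isTree a ℓ v a' ℓ' v' hℓ hv hℓ' hv' heq := by
    have h1 := hw heq
    simp only [Sum.inl.injEq, Prod.mk.injEq, Fin.ext_iff, Fin.val_ofNat] at h1
    have hlt : ∀ {ℓ v}, ℓ ≤ h → v < 2 ^ ℓ → 2 ^ ℓ + v < 2 ^ (h + 1) := fun {ℓ v} hℓ hv => by
      have : 2 ^ ℓ ≤ 2 ^ h := Nat.pow_le_pow_right (by omega) hℓ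
      rw [pow_succ]
      omega
    rw [Nat.mod_eq_of_lt (hlt hℓ hv), Nat.mod_eq_of_lt (hlt hℓ' hv')] at h1
    refine ⟨Fin.ext h1.1, ?_⟩
    have h2 : ℓ = ℓ' := by
      rcases lt_trichotomy ℓ ℓ' with hl | hl | hl
      · have : 2 ^ (ℓ + 1) ≤ 2 ^ ℓ' := Nat.pow_le_pow_right (by omega) hl
        rw [pow_succ] at this
        omega
      · exact hl
      · have : 2 ^ (ℓ' + 1) ≤ 2 ^ ℓ := Nat.pow_le_pow_right (by omega) hl
        rw [pow_succ] at this
        omega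
    subst h2
    exact ⟨rfl, by omega⟩
  row_inj a i a' i' hi hi' heq := by
    have h1 := hw heq
    simp only [Sum.inr.injEq, Sum.inl.injEq, Prod.mk.injEq, Fin.ext_iff, Fin.val_ofNat] at h1
    rw [Nat.mod_eq_of_lt hi, Nat.mod_eq_of_lt hi'] at h1
    exact ⟨Fin.ext h1.1, h1.2⟩
  tree_ne_row a j v a' i hj hv hi heq := by simpa using hw heq
  chain_inj i j hi hj heq := by
    have h1 := hw heq
    simp only [Sum.inr.injEq, Fin.ext_iff, Fin.val_ofNat] at h1
    rwa [Nat.mod_eq_of_lt (by omega), Nat.mod_eq_of_lt (by omega)] at h1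
  chain_notMem i hi := by
    rintro (⟨a, j, v, -, -, heq⟩ | ⟨a, j, -, heq⟩)
    · simpa using hw heq
    · simpa using hw heq

lemma Workspace.allQubits_ofInjective {h L : ℕ} {Q : Type} (w : WorkIndex h L → Q)
    (hw : Injective w) : (ofInjective w hw).allQubits ⊆ Set.range w := by
  rintro q ((⟨a, j, v, -, -, rfl⟩ | ⟨a, j, -, rfl⟩) | ⟨j, -, rfl⟩) <;> exact ⟨_, rfl⟩

/-- Labels of the ancillas: the work qubits, a scratch register of `K` qubits, a flag for each of
the tests of the `2 m` costs, and two qubits for the conditions that select the gate. -/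
abbrev AncillaIndex (h L K m : ℕ) := WorkIndex h L ⊕ Fin K ⊕ (Bool × Fin m) ⊕ Bool

section Allocation

variable {n m κ a h L K : ℕ}

/-- The ancilla with a given label. -/
def ancilla (e : AncillaIndex h L K m ≃ Fin a) (i : AncillaIndex h L K m) : RegQubit n m κ a :=
  .inr (.inr (e i))

lemma ancilla_injective (e : AncillaIndex h L K m ≃ Fin a) :
    Injective (ancilla (n := n) (κ := κ) e) := fun i j hij => by
  simpa [ancilla] using hij

/-- The workspace on the ancillas. -/
def workspace (e : AncillaIndex h L K m ≃ Fin a) : Workspace h L (RegQubit n m κ a) :=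
  .ofInjective (fun i => ancilla e (.inl i))
    ((ancilla_injective e).comp Sum.inl_injective)

lemma exists_of_mem_workspace {e : AncillaIndex h L K m ≃ Fin a} {q : RegQubit n m κ a}
    (hq : q ∈ (workspace e).allQubits) : ∃ i, ancilla e (.inl i) = q :=
  Workspace.allQubits_ofInjective _ _ hq

lemma all_map_inl {b : RegQubit n m κ a → Bool} {x : Fin n → Bool} {A : Finset (Fin n)}
    (hb : ∀ j ∈ A, b (.inl j) = x j) :
    ((A.toList.map Sum.inl).all b) = decide (∀ j ∈ A, x j = true) := by
  rw [Bool.eq_iff_iff, List.all_eq_true, decide_eq_true_iff]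
  simp only [List.mem_map, Finset.mem_toList, forall_exists_index, and_imp,
    forall_apply_eq_imp_iff₂]
  exact forall₂_congr fun j hj => by rw [hb j hj]

variable (I : SumConstraints n m)

/-- The flag of a test receives the truth value of "the cost is at most the register content". -/
lemma exists_costTest (e : AncillaIndex h L (κ + n + 2) m ≃ Fin a) (hh : κ + n + 2 ≤ 2 ^ h)
    (hκ : 1 ≤ κ) (hL : n + 1 ≤ L) (t : Fin n) (s : Bool) (k : Fin m) {N : ℕ}
    (hN : (I.terms t k s).card ≤ N) :
    ∃ f, Realizable {.inl t}ᶜ (2 * (1 + (N + 1) * (2 * (n + 1 + 1) + (26 * h + 22))) + 2) f ∧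
      ∀ (c : RegConfig n m κ) (b : RegQubit n m κ a → Bool),
        (∀ q, (∀ i ≠ (s, k), ancilla e (.inr (.inr (.inl i))) ≠ q) → b q = encode a c q) →
        f b = update b (ancilla e (.inr (.inr (.inl (s, k)))))
          (decide (I.costOf t c.1 k s ≤ (c.2 k).toInt)) := by
  set r : Fin κ → RegQubit n m κ a := fun i => .inr (.inl (k, i)) with hr
  set R : Fin (κ + n + 2) → RegQubit n m κ a := fun i => ancilla e (.inr (.inl i)) with hRdef
  set y : RegQubit n m κ a := ancilla e (.inr (.inr (.inl (s, k)))) with hy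
  -- the sign bit of the register controls the correction by `-2 ^ κ`
  set l : List (List (RegQubit n m κ a) × BitVec (κ + n + 2)) :=
    ([r ⟨κ - 1, by omega⟩], BitVec.ofInt _ (-2 ^ κ)) :: (I.terms t k s).toList.map fun S =>
      ((SumConstraints.controls t s S).toList.map Sum.inl,
        BitVec.ofInt _ (-((min (I.w S k).natAbs (2 ^ κ) : ℕ) : ℤ))) with hl
  have hanc : ∀ i j, i ≠ j → ancilla (n := n) (κ := κ) e i ≠ ancilla e j := fun i j hij h =>
    hij (ancilla_injective e h)
  have hlq : ∀ p ∈ l, p.1.length ≤ n + 1 ∧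
      ∀ q ∈ p.1, q ≠ .inl t ∧ ∀ i, ancilla e i ≠ q := by
    rw [hl, List.forall_mem_cons]
    constructor
    · simp [hr, ancilla]
    · intro p hp
      obtain ⟨S, -, rfl⟩ := List.mem_map.1 hp
      constructor
      · rw [List.length_map, Finset.length_toList]
        exact (Finset.card_le_univ _).trans (by simp)
      · intro q hq
        obtain ⟨j, hj, rfl⟩ := List.mem_map.1 hq
        rw [Finset.mem_toList] at hj
        exact ⟨fun h => SumConstraints.notMem_controls t s S (Sum.inl_injective h ▸ hj),
          fun i h => by simp [ancilla] at h⟩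
  have hwork : ∀ q ∈ (workspace (n := n) (κ := κ) e).allQubits, ∃ i, ancilla e (.inl i) = q :=
    fun q hq => exists_of_mem_workspace hq
  obtain ⟨f, hf, hfb⟩ := (workspace (n := n) (κ := κ) e).exists_signTest (S := {.inl t}ᶜ) hh
    (by omega) (r := r) (fun i j hij => by simpa [hr] using hij) (R := R)
    (fun i j hij => by simpa using ancilla_injective e hij)
    (fun i hi => by
      obtain ⟨j, hj⟩ := hwork _ hi
      simpa using ancilla_injective e hj)
    (fun i j h => by simp [hr, hRdef, ancilla] at h) (y := y)
    (fun hi => by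
      obtain ⟨j, hj⟩ := hwork _ hi
      simpa using ancilla_injective e hj)
    (fun i h => by simp [hr, hy, ancilla] at h)
    (fun i => hanc _ _ (by simp))
    (fun q hq => by
      obtain ⟨j, rfl⟩ := hwork _ hq
      simp [ancilla]) (fun i => by simp [hr]) (fun i => by simp [hRdef, ancilla])
    (by simp [hy, ancilla]) hL l (fun p hp => (hlq p hp).1)
    (fun p hp q hq hw => by
      obtain ⟨j, hj⟩ := hwork _ hw
      exact ((hlq p hp).2 q hq).2 _ hj)
    (fun p hp q hq i => ((hlq p hp).2 q hq).2 _)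
    (fun p hp q hq h => ((hlq p hp).2 q hq).2 _ h.symm)
    (fun p hp q hq => ((hlq p hp).2 q hq).1)
  have hlen : l.length ≤ N + 1 := by
    rw [hl, List.length_cons, List.length_map, Finset.length_toList]
    omega
  refine ⟨f, hf.mono le_rfl (by gcongr), fun c b hb => ?_⟩
  have hbanc : ∀ i, (∀ j ≠ (s, k), i ≠ .inr (.inr (.inl j))) → b (ancilla e i) = false :=
    fun i hi => hb _ fun j hj h => hi j hj (ancilla_injective e h).symm
  have hbx : ∀ j, b (.inl j) = c.1 j := fun j => hb _ fun i _ h => by simp [ancilla] at h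
  have hbr : ∀ i, b (r i) = (c.2 k).getLsbD i := fun i => hb _ fun i _ h => by
    simp [ancilla, hr] at h
  rw [hfb b (c.2 k)
    (fun q hq => by
      obtain ⟨j, rfl⟩ := hwork _ hq
      exact hbanc _ (by simp))
    (fun i => hbanc _ (by simp)) hbr (hbanc _ fun j hj h => hj (by simpa using h.symm))]
  congr 1
  have hmsb : [r ⟨κ - 1, by omega⟩].all b = (c.2 k).msb := by
    simp only [List.all_cons, List.all_nil, Bool.and_true, hbr]
    rw [BitVec.msb_eq_getLsbD_last]
  have hsum : (l.map fun p => if p.1.all b then p.2 else 0).sum =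
      BitVec.ofInt _ ((if (c.2 k).msb then -2 ^ κ else 0) +
        ∑ S ∈ I.terms t k s, if ∀ j ∈ SumConstraints.controls t s S, c.1 j = true then
          -((min (I.w S k).natAbs (2 ^ κ) : ℕ) : ℤ) else 0) := by
    rw [hl, List.map_cons, List.sum_cons, hmsb, List.map_map, BitVec.ofInt_add]
    congr 1
    · split_ifs <;> simp
    · simp only [comp_def, all_map_inl (fun j _ => hbx j)]
      rw [sum_map_ite_ofInt, Finset.sum_map_toList]
      simp
  rw [hsum]
  have hcard : (I.terms t k s).card ≤ 2 ^ n := by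
    refine (Finset.card_le_univ _).trans ?_
    simp
  have := msb_eq_false_iff_sum_le (n := n) (I.terms t k s) hcard
    (fun S => ∀ j ∈ SumConstraints.controls t s S, c.1 j = true) (fun S => (I.w S k).natAbs) (c.2 k)
  rw [Bool.eq_iff_iff, Bool.not_eq_true', this, decide_eq_true_iff, I.costOf_eq_sum]

open Classical in
/-- The conditions that select the gate on qubit `t` are computed on two ancillas, by a circuit that
does not touch qubit `t`. -/
lemma exists_conditions (e : AncillaIndex h L (κ + n + 2) m ≃ Fin a) (hh : κ + n + 2 ≤ 2 ^ h)
    (hκ : 1 ≤ κ) (hL : n + 1 ≤ L) (hmL : 2 * m ≤ L) (t : Fin n) {N : ℕ}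
    (hN : ∀ k s, (I.terms t k s).card ≤ N) :
    ∃ f, Realizable {.inl t}ᶜ
      (2 * m * (2 * (1 + (N + 1) * (2 * (n + 1 + 1) + (26 * h + 22))) + 2) + (6 * m + 7)) f ∧
      ∀ c : RegConfig n m κ,
        (f (encode a c) (ancilla e (.inr (.inr (.inr true)))) = true ↔
          I.bPlus t c ∧ I.bMinus t c) ∧
        (f (encode a c) (ancilla e (.inr (.inr (.inr false)))) = true ↔
          I.bPlus t c ∧ ¬ I.bMinus t c) := by
  set F : Bool × Fin m → RegQubit n m κ a := fun j => ancilla e (.inr (.inr (.inl j))) with hF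
  set y : Bool → RegQubit n m κ a := fun s => ancilla e (.inr (.inr (.inr s))) with hy
  have hFinj : Injective F := fun i j hij => by simpa using ancilla_injective e hij
  have hyF : ∀ s j, F j ≠ y s := fun s j h => by simpa using ancilla_injective e h
  obtain ⟨f, hf, hfb⟩ := Realizable.exists_blocks (ι := Unit) (S := {.inl t}ᶜ)
    (d := 2 * (1 + (N + 1) * (2 * (n + 1 + 1) + (26 * h + 22))) + 2) (fun j _ => F j)
    (fun i j hij => by simpa [Prod.ext_iff] using hFinj hij) (encode a)
    (fun j (c : RegConfig n m κ) _ => decide (I.costOf t c.1 j.2 j.1 ≤ (c.2 j.2).toInt))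
    (by
      intro j
      obtain ⟨g, hg, hgb⟩ := exists_costTest I e hh hκ hL t j.1 j.2 (hN j.2 j.1)
      refine ⟨g, hg, fun c b hb => ?_⟩
      rw [hgb c b fun q hq => hb q fun i hi _ => hq i hi, extend_unit])
  have hwork : ∀ q ∈ (workspace (n := n) (κ := κ) e).allQubits, ∃ i, ancilla e (.inl i) = q :=
    fun q hq => exists_of_mem_workspace hq
  have hFA : ∀ j, F j ∉ (workspace (n := n) (κ := κ) e).allQubits := fun j hj => by
    obtain ⟨i, hi⟩ := hwork _ hj
    simpa using ancilla_injective e hi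
  have hyA : ∀ s, y s ∉ (workspace (n := n) (κ := κ) e).allQubits := fun s hs => by
    obtain ⟨i, hi⟩ := hwork _ hs
    simpa using ancilla_injective e hi
  have hAS : (workspace (n := n) (κ := κ) e).allQubits ⊆ {.inl t}ᶜ := fun q hq => by
    obtain ⟨j, rfl⟩ := hwork _ hq
    simp [ancilla]
  -- the conjunction of all the flags, and that of the flags of the costs of `x_t = 1`
  set l₁ := (Finset.univ : Finset (Bool × Fin m)).toList.map F with hl₁
  set l₂ := (Finset.univ : Finset (Fin m)).toList.map fun k => F (true, k) with hl₂
  have hlen₁ : l₁.length = 2 * m := by simp [hl₁]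
  have hlen₂ : l₂.length = m := by simp [hl₂]
  have hmem₁ : ∀ q ∈ l₁, ∃ j, F j = q := by simp [hl₁]
  have hmem₂ : ∀ q ∈ l₂, ∃ j, F j = q := fun q hq => by
    obtain ⟨k, -, rfl⟩ := List.mem_map.1 hq
    exact ⟨_, rfl⟩
  have hin : ∀ {l : List (RegQubit n m κ a)} (_ : l.length ≤ L) (_ : ∀ q ∈ l, ∃ j, F j = q) (s),
      ∃ g, Realizable {.inl t}ᶜ (2 * l.length + 3) g ∧ ∀ b : RegQubit n m κ a → Bool,
        (∀ q ∈ (workspace (n := n) (κ := κ) e).allQubits, b q = false) →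
        g b = update b (y s) (b (y s) ^^ l.all b) := by
    intro l hlL hl s
    refine (workspace (n := n) (κ := κ) e).exists_andInto hlL ?_ (hyA s) ?_ hAS ?_
      (by simp [hy, ancilla])
    · intro q hq
      obtain ⟨j, rfl⟩ := hl q hq
      exact hFA j
    · intro hq
      obtain ⟨j, hj⟩ := hl _ hq
      exact hyF s j hj
    · intro q hq
      obtain ⟨j, rfl⟩ := hl q hq
      simp [hF, ancilla]
  obtain ⟨g₁, hg₁, hg₁b⟩ := hin (by omega) hmem₁ true
  obtain ⟨g₂, hg₂, hg₂b⟩ := hin (by omega) hmem₂ false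
  have hyy : y true ≠ y false := fun h => by simpa using ancilla_injective e h
  have gate := Realizable.cnot_gate (S := {Sum.inl t}ᶜ) (y true) (y false) hyy
    (by simp [hy, ancilla]) (by simp [hy, ancilla])
  refine ⟨_, (((hf.comp hg₁).comp hg₂).comp gate).mono le_rfl ?_, fun c => ?_⟩
  · rw [hlen₁, hlen₂, Fintype.card_prod, Fintype.card_bool, Fintype.card_fin]
    omega
  · have e0 : ∀ q, (∀ j, F j ≠ q) → f (encode a c) q = encode a c q := fun q hq => by
      rw [hfb, extend_of_forall_ne (t := uncurry fun j (_ : Unit) => F j) fun j => hq j.1]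
    have eF : ∀ j, f (encode a c) (F j) = decide (I.costOf t c.1 j.2 j.1 ≤ (c.2 j.2).toInt) := by
      intro j
      rw [hfb]
      exact Injective.extend_apply (f := uncurry fun j (_ : Unit) => F j)
        (fun i j hij => by simpa [Prod.ext_iff] using hFinj hij) _ _ (j, ())
    have eW : ∀ q ∈ (workspace (n := n) (κ := κ) e).allQubits, f (encode a c) q = false := by
      intro q hq
      rw [e0 q fun j hj => hFA j (hj ▸ hq)]
      obtain ⟨i, rfl⟩ := hwork q hq
      rfl
    have ey : ∀ s, f (encode a c) (y s) = false := fun s => e0 _ (hyF s)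
    have h1 : l₁.all (f (encode a c)) = decide (I.bPlus t c ∧ I.bMinus t c) := by
      rw [Bool.eq_iff_iff, List.all_eq_true, decide_eq_true_iff]
      simp only [hl₁, List.mem_map, Finset.mem_toList, Finset.mem_univ, true_and,
        forall_exists_index, forall_apply_eq_imp_iff, eF, decide_eq_true_iff]
      rw [Prod.forall, Bool.forall_bool]
      exact and_comm
    have e1 := hg₁b _ eW
    rw [ey, h1, Bool.false_xor] at e1
    have e1F : ∀ j, g₁ (f (encode a c)) (F j) = f (encode a c) (F j) := fun j => by
      rw [e1, update_of_ne (hyF true j)]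
    have h2 : l₂.all (g₁ (f (encode a c))) = decide (I.bPlus t c) := by
      rw [Bool.eq_iff_iff, List.all_eq_true, decide_eq_true_iff]
      simp only [hl₂, List.mem_map, Finset.mem_toList, Finset.mem_univ, true_and,
        forall_exists_index, forall_apply_eq_imp_iff, e1F, eF, decide_eq_true_iff]
      rfl
    have e2 := hg₂b (g₁ (f (encode a c))) fun q hq => by
      rw [e1, update_of_ne fun h : q = y true => hyA true (h ▸ hq), eW q hq]
    rw [h2, e1, update_of_ne hyy.symm, ey, Bool.false_xor] at e2
    set b := g₂ (g₁ (f (encode a c))) with hb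
    change (update b (y false) (b (y false) ^^ b (y true)) (y true) = true ↔ _) ∧
      (update b (y false) (b (y false) ^^ b (y true)) (y false) = true ↔ _)
    rw [hb, update_of_ne hyy, update_self, e1, e2, update_self, update_of_ne hyy, update_self]
    by_cases hp : I.bPlus t c <;> by_cases hm : I.bMinus t c <;> simp [hp, hm]

/-- Subtracting the cost of one of the two values of `x_t` from a register, on condition that
`x_t = 1`. -/
lemma exists_costSubtraction (e : AncillaIndex h L K m ≃ Fin a) (hh : κ ≤ 2 ^ h)
    (hL : n + 1 ≤ L) (t : Fin n) (s : Bool) (k : Fin m) {N : ℕ} (hN : (I.terms t k s).card ≤ N) :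
    ∃ f, Realizable Set.univ (N * (2 * (n + 1 + 1) + (26 * h + 22))) f ∧
      ∀ (x : Fin n → Bool) (u : BitVec κ) (b : RegQubit n m κ a → Bool),
        (∀ i, b (ancilla e i) = false) → (∀ j ≠ t, b (.inl j) = x j) →
        (∀ i : Fin κ, b (.inr (.inl (k, i))) = u.getLsbD i) →
        f b = extend (fun i : Fin κ => .inr (.inl (k, i)))
          (fun i => (u - if b (.inl t) then BitVec.ofInt κ (I.costOf t x k s) else 0).getLsbD i)
          b := by
  set r : Fin κ → RegQubit n m κ a := fun i => .inr (.inl (k, i)) with hr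
  set l : List (List (RegQubit n m κ a) × BitVec κ) := (I.terms t k s).toList.map fun S =>
      (Sum.inl t :: (SumConstraints.controls t s S).toList.map Sum.inl,
        BitVec.ofInt _ (-((I.w S k).natAbs : ℤ))) with hl
  have hlq : ∀ p ∈ l, p.1.length ≤ n + 1 ∧ ∀ q ∈ p.1, ∃ j, q = .inl j := by
    intro p hp
    obtain ⟨S, -, rfl⟩ := List.mem_map.1 hp
    constructor
    · rw [List.length_cons, List.length_map, Finset.length_toList]
      have := Finset.card_le_univ (SumConstraints.controls t s S)
      rw [Fintype.card_fin] at this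
      omega
    · intro q hq
      rcases List.mem_cons.1 hq with rfl | hq
      · exact ⟨t, rfl⟩
      · obtain ⟨j, -, rfl⟩ := List.mem_map.1 hq
        exact ⟨j, rfl⟩
  have hwork : ∀ q ∈ (workspace (n := n) (κ := κ) e).allQubits, ∃ i, ancilla e (.inl i) = q :=
    fun q hq => exists_of_mem_workspace hq
  obtain ⟨f, hf, hfb⟩ := (workspace (n := n) (κ := κ) e).exists_batchAdd (S := Set.univ) hh
    (reg := r) (fun i j hij => by simpa [hr] using hij)
    (fun i hi => by
      obtain ⟨j, hj⟩ := hwork _ hi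
      simp [ancilla, hr] at hj)
    (Set.subset_univ _) (fun _ => Set.mem_univ _) hL l (fun p hp => (hlq p hp).1)
    (fun p hp q hq hw => by
      obtain ⟨j, rfl⟩ := (hlq p hp).2 q hq
      obtain ⟨i, hi⟩ := hwork _ hw
      simp [ancilla] at hi)
    (fun p hp q hq i => by
      obtain ⟨j, rfl⟩ := (hlq p hp).2 q hq
      simp [hr])
    (fun _ _ _ _ => Set.mem_univ _)
  have hlen : l.length ≤ N := by
    rwa [hl, List.length_map, Finset.length_toList]
  refine ⟨f, hf.mono le_rfl (by gcongr), fun x u b hb hbx hbr => ?_⟩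
  have hsum : (l.map fun p => if p.1.all b then p.2 else 0).sum =
      -(if b (.inl t) then BitVec.ofInt κ (I.costOf t x k s) else 0) := by
    rw [hl, List.map_map]
    have hall : ∀ S, ((SumConstraints.controls t s S).toList.map Sum.inl).all b =
        decide (∀ j ∈ SumConstraints.controls t s S, x j = true) := fun S =>
      all_map_inl fun j hj => hbx j fun h => SumConstraints.notMem_controls t s S (h ▸ hj)
    simp only [comp_def, List.all_cons, hall]
    rw [sum_map_ite_ofInt, Finset.sum_map_toList]
    cases b (.inl t)
    · simp
    · simp only [Bool.true_and, decide_eq_true_iff, if_true]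
      rw [I.costOf_eq_sum, ← BitVec.ofInt_neg, ← Finset.sum_neg_distrib]
      congr 1
      exact Finset.sum_congr rfl fun S _ => by split_ifs <;> simp
  rw [hfb b u (fun q hq => by
    obtain ⟨i, rfl⟩ := hwork q hq
    exact hb _) hbr, hsum]
  simp only [BitVec.sub_eq_add_neg]

/-- The subtractions of the oracle as a classical circuit. The qubit `x_t` is negated while the
cost of `x_t = 0` is subtracted. -/
lemma exists_subtractions (e : AncillaIndex h L K m ≃ Fin a) (hh : κ ≤ 2 ^ h)
    (hL : n + 1 ≤ L) (t : Fin n) {N : ℕ} (hN : ∀ k s, (I.terms t k s).card ≤ N) :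
    ∃ f, Realizable Set.univ (m * (2 * (N * (2 * (n + 1 + 1) + (26 * h + 22))) + 2)) f ∧
      ∀ c : RegConfig n m κ, f (encode a c) =
        encode a (c.1, fun k => c.2 k - BitVec.ofInt κ (I.cost t c.1 k)) := by
  set r : Fin m → Fin κ → RegQubit n m κ a := fun k i => .inr (.inl (k, i)) with hr
  have hrinj : Injective (uncurry r) := fun p q hpq => by
    simpa [hr, uncurry, Prod.ext_iff] using hpq
  obtain ⟨f, hf, hfb⟩ := Realizable.exists_blocks (S := Set.univ)
    (d := 2 * (N * (2 * (n + 1 + 1) + (26 * h + 22))) + 2) r hrinj (encode a)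
    (fun k (c : RegConfig n m κ) i => (c.2 k - BitVec.ofInt κ (I.cost t c.1 k)).getLsbD i)
    (by
      intro k
      obtain ⟨f, hf, hfb⟩ := exists_costSubtraction I e hh hL t true k (hN k true)
      obtain ⟨g, hg, hgb⟩ := exists_costSubtraction I e hh hL t false k (hN k false)
      have neg := Realizable.not_gate (S := {Sum.inl t}) (Sum.inl t : RegQubit n m κ a) rfl
      obtain ⟨g', hg', hg'b⟩ := neg.exists_conj (t := r k) hg (by simp [hr]) (Set.subset_univ _)
      refine ⟨_, (hf.comp hg').mono le_rfl (by omega), fun c b hb => ?_⟩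
      have hbx : ∀ j, b (.inl j) = c.1 j := fun j => hb _ (by simp [hr])
      have hbe : ∀ i, b (ancilla e i) = false := fun i => hb _ (by simp [hr, ancilla])
      have hbr : ∀ i, b (r k i) = (c.2 k).getLsbD i := fun i =>
        hb _ (by simp +contextual [hr])
      have hfv := hfb c.1 (c.2 k) b hbe (fun j _ => hbx j) hbr
      set b' := f b with hb'
      have hb'q : ∀ q, (∀ i, r k i ≠ q) → b' q = b q := fun q hq => by
        rw [hfv, extend_of_forall_ne hq]
      have hgv := hg'b b' _ (hgb c.1
        (c.2 k - if b (.inl t) then BitVec.ofInt κ (I.costOf t c.1 k true) else 0)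
        (update b' (.inl t) (!b' (.inl t)))
        (fun i => by
          rw [update_of_ne (by simp [ancilla]), hb'q _ (by simp [hr, ancilla]), hbe])
        (fun j hj => by
          rw [update_of_ne (by simpa using hj), hb'q _ (by simp [hr]), hbx])
        (fun i => by
          rw [update_of_ne (by simp), hfv]
          exact Injective.extend_apply (f := r k) (fun i j hij => by simpa [hr] using hij) _ _ i))
      rw [hgv, update_self, hb'q _ (by simp [hr]), hbx, hfv, extend_extend_same,
        I.cost_eq_costOf]
      cases c.1 t <;> simp)
  refine ⟨f, hf.mono le_rfl (by rw [Fintype.card_fin]), fun c => ?_⟩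
  rw [hfb]
  ext q
  by_cases hq : ∃ p, uncurry r p = q
  · obtain ⟨p, rfl⟩ := hq
    rw [hrinj.extend_apply]
    rfl
  · rw [extend_apply' _ _ _ hq]
    rcases q with i | ⟨k, i⟩ | i
    · rfl
    · exact absurd ⟨(k, i), rfl⟩ hq
    · rfl

end Allocation

/-! ### Depth and number of qubits -/

section Cost

variable {n m κ a h L : ℕ} (I : SumConstraints n m)

lemma exists_oracleCircuit (e : AncillaIndex h L (κ + n + 2) m ≃ Fin a) (hh : κ + n + 2 ≤ 2 ^ h)
    (hκ : 1 ≤ κ) (hm : 1 ≤ m) (hL : n + 1 ≤ L) (hmL : 2 * m ≤ L) (θ : ℝ) (t : Fin n) {N : ℕ}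
    (hN : ∀ k, (Finset.univ.filter fun S : Finset (Fin n) => I.w S k ≠ 0).card ≤ N) :
    ∃ C : QCircuit (RegQubit n m κ a),
      C.length ≤ 338 * (m * (N + 1) * (n + 2) * (h + 1)) ∧ Implements C (I.oracle θ t) := by
  have hN' : ∀ k s, (I.terms t k s).card ≤ N := fun k s => (I.card_terms_le t k s).trans (hN k)
  obtain ⟨f, ⟨P, hPlen, hP, rfl⟩, hPc⟩ := exists_conditions I e hh hκ hL hmL t hN'
  obtain ⟨g, ⟨D, hDlen, hD, rfl⟩, hDc⟩ :=
    exists_subtractions (κ := κ) I e (by omega) hL t hN'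
  refine ⟨_, ?_, implements_oracle I θ t hP hD (by simp [ancilla]) (by simp [ancilla])
    (fun s => (hPc s).1) (fun s => (hPc s).2) hDc⟩
  simp only [List.length_append, List.length_cons, List.length_nil, QCircuit.length_inv]
  set B := 2 * (n + 1 + 1) + (26 * h + 22) with hB
  have h1 : B ≤ 26 * ((n + 2) * (h + 1)) := by rw [hB]; nlinarith
  have h2 : 26 ≤ B := by omega
  have h3 : 26 * (m * (N + 1)) ≤ m * (N + 1) * B := by
    rw [mul_comm 26]
    exact Nat.mul_le_mul_left _ h2
  have h4 : m ≤ m * (N + 1) := Nat.le_mul_of_pos_right _ (by omega)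
  have h5 : m * (N * B) ≤ m * (N + 1) * B := by
    rw [mul_assoc]
    gcongr
    omega
  calc P.length + (0 + 1 + 1 + (P.length + D.length))
      ≤ 13 * (m * (N + 1) * B) := by nlinarith
    _ ≤ 13 * (m * (N + 1) * (26 * ((n + 2) * (h + 1)))) := by gcongr
    _ = _ := by ring

lemma run_flatten (θ : Fin n → ℝ) {circ : Fin n → QCircuit (RegQubit n m κ a)}
    (hcirc : ∀ t, Implements (circ t) (I.oracle (θ t) t)) :
    QCircuit.run (List.ofFn circ).flatten (withAncillas a (I.initialState κ)) =
      withAncillas a (I.stateAfter κ θ n) := by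
  have key : ∀ t ≤ n, QCircuit.run ((List.ofFn circ).take t).flatten
      (withAncillas a (I.initialState κ)) = withAncillas a (I.stateAfter κ θ t) := by
    intro t
    induction t with
    | zero => intro _; rfl
    | succ t ih =>
      intro ht
      have htn : t < n := ht
      rw [List.take_add_one, List.flatten_append, QCircuit.run_append, ih (by omega)]
      simp only [List.getElem?_ofFn, htn, dif_pos, Option.toList_some, List.flatten_cons,
        List.flatten_nil, List.append_nil, SumConstraints.stateAfter]
      exact hcirc ⟨t, htn⟩ _
  have h1 := key n le_rfl
  rwa [List.take_of_length_le (by simp)] at h1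

lemma length_flatten_ofFn_le {α : Type} {circ : Fin n → List α} {D : ℕ}
    (h : ∀ t, (circ t).length ≤ D) : (List.ofFn circ).flatten.length ≤ n * D := by
  rw [List.length_flatten, List.map_ofFn, List.sum_ofFn]
  calc ∑ i, (List.length ∘ circ) i ≤ ∑ _i : Fin n, D := Finset.sum_le_sum fun i _ => h i
    _ = n * D := by simp

/-- The height of the adder tree is `O(log n + log κ)`; as `n κ ≥ 2`, the additive constants are
absorbed. -/
lemma clog_add_one_le (hnκ : 2 ≤ n * κ) :
    ((Nat.clog 2 (κ + n + 2) + 1 : ℕ) : ℝ) ≤ 5 * (Real.logb 2 n + Real.logb 2 κ) := by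
  have hn : 1 ≤ n := Nat.pos_of_ne_zero (by rintro rfl; simp at hnκ)
  have hκ : 1 ≤ κ := Nat.pos_of_ne_zero (by rintro rfl; simp at hnκ)
  have hpow : 2 ^ (Nat.clog 2 (κ + n + 2) - 1) < κ + n + 2 :=
    Nat.pow_pred_clog_lt_self (b := 2) (x := κ + n + 2) (by norm_num) (by omega)
  have hle : κ + n + 2 ≤ 4 * (n * κ) := by nlinarith
  rw [← Real.logb_mul (by positivity) (by positivity)]
  have hprod : (2 : ℝ) ≤ n * κ := by exact_mod_cast hnκ
  have h1 : 1 ≤ Real.logb 2 (n * κ : ℝ) := by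
    rw [Real.le_logb_iff_rpow_le (by norm_num) (by linarith)]
    simpa using hprod
  have h2 : ((Nat.clog 2 (κ + n + 2) - 1 : ℕ) : ℝ) ≤ 2 + Real.logb 2 (n * κ : ℝ) := by
    have h4 : Real.logb 2 (4 * (n * κ) : ℝ) = 2 + Real.logb 2 (n * κ : ℝ) := by
      rw [Real.logb_mul (by norm_num) (by linarith), show (4 : ℝ) = 2 ^ (2 : ℝ) by norm_num,
        Real.logb_rpow (by norm_num) (by norm_num)]
    rw [← h4, Real.le_logb_iff_rpow_le (by norm_num) (by linarith), Real.rpow_natCast]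
    exact_mod_cast (hpow.trans_le hle).le
  have h3 : ((Nat.clog 2 (κ + n + 2) + 1 : ℕ) : ℝ) ≤
      ((Nat.clog 2 (κ + n + 2) - 1 : ℕ) : ℝ) + 2 := by
    norm_cast
  linarith

lemma card_ancillaIndex_le (hnκ : 2 ≤ n * κ) (hm : 1 ≤ m) :
    n + m * κ + Fintype.card (AncillaIndex (Nat.clog 2 (κ + n + 2)) (n + 1 + 2 * m) (κ + n + 2) m) ≤
      45 * (n + m * κ) := by
  have hκ : 1 ≤ κ := Nat.pos_of_ne_zero (by rintro rfl; simp at hnκ)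
  have hn : 1 ≤ n := Nat.pos_of_ne_zero (by rintro rfl; simp at hnκ)
  have hpow : 2 ^ (Nat.clog 2 (κ + n + 2) - 1) < κ + n + 2 :=
    Nat.pow_pred_clog_lt_self (b := 2) (x := κ + n + 2) (by norm_num) (by omega)
  have hpos : 0 < Nat.clog 2 (κ + n + 2) := Nat.clog_pos (by norm_num) (by omega)
  have h2 : 2 ^ Nat.clog 2 (κ + n + 2) = 2 * 2 ^ (Nat.clog 2 (κ + n + 2) - 1) := by
    rw [← pow_succ', Nat.sub_add_cancel hpos]
  have h3 : κ ≤ m * κ := Nat.le_mul_of_pos_left _ hm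
  have h4 : m ≤ m * κ := Nat.le_mul_of_pos_right _ hκ
  simp only [Fintype.card_sum, Fintype.card_prod, Fintype.card_fin, Fintype.card_bool, pow_succ, h2]
  omega

/-- Circuits for all the oracles, of polynomial times `m (log n + log κ)` total depth and with a
linear number of qubits. -/
lemma exists_circuits (p : Polynomial ℕ) (θ : Fin n → ℝ) (hm : 1 ≤ m) (hnκ : 2 ≤ n * κ)
    (hp : ∀ k, (Finset.univ.filter fun S : Finset (Fin n) => I.w S k ≠ 0).card ≤ p.eval n) :
    ∃ (a : ℕ) (circ : Fin n → QCircuit (RegQubit n m κ a)),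
      (∀ t, Implements (circ t) (I.oracle (θ t) t)) ∧
      QCircuit.run (List.ofFn circ).flatten (withAncillas a (I.initialState κ)) =
        withAncillas a (I.stateAfter κ θ n) ∧
      ((List.ofFn circ).flatten.length : ℝ) ≤
        ((Polynomial.C 1690 * Polynomial.X * (p + 1) * (Polynomial.X + 2)).eval n : ℕ) * m *
          (Real.logb 2 n + Real.logb 2 κ) ∧
      Fintype.card (RegQubit n m κ a) ≤ 45 * (n + m * κ) := by
  have hκ : 1 ≤ κ := Nat.pos_of_ne_zero (by rintro rfl; simp at hnκ)
  set h := Nat.clog 2 (κ + n + 2) with hh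
  set e := Fintype.equivFin (AncillaIndex h (n + 1 + 2 * m) (κ + n + 2) m)
  choose circ hlen hcirc using fun t => exists_oracleCircuit I e
    (Nat.le_pow_clog (by norm_num) _) hκ hm (by omega) (by omega) (θ t) t hp
  refine ⟨_, circ, hcirc, run_flatten I θ hcirc, ?_, ?_⟩
  · have h1 : ((List.ofFn circ).flatten.length : ℝ) ≤
        ((n * (338 * (m * (p.eval n + 1) * (n + 2) * (h + 1))) : ℕ) : ℝ) := by
      exact_mod_cast length_flatten_ofFn_le hlen
    have h2 := clog_add_one_le hnκ
    rw [← hh] at h2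
    refine h1.trans ?_
    calc ((n * (338 * (m * (p.eval n + 1) * (n + 2) * (h + 1))) : ℕ) : ℝ)
        = (338 * n * (p.eval n + 1) * (n + 2) * m : ℝ) * ((h + 1 : ℕ) : ℝ) := by
          push_cast; ring
      _ ≤ (338 * n * (p.eval n + 1) * (n + 2) * m : ℝ) *
          (5 * (Real.logb 2 n + Real.logb 2 κ)) := by gcongr
      _ = _ := by
          simp only [Polynomial.eval_mul, Polynomial.eval_add, Polynomial.eval_C,
            Polynomial.eval_X, Polynomial.eval_one, Polynomial.eval_ofNat]
          push_cast
          ring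
  · have h1 := card_ancillaIndex_le hnκ hm
    rw [← hh] at h1
    calc _ = n + m * κ + Fintype.card (AncillaIndex h (n + 1 + 2 * m) (κ + n + 2) m) := by
          simp only [Fintype.card_sum, Fintype.card_prod, Fintype.card_fin]
          ring
      _ ≤ _ := h1

end Cost

/-! ### Remaining potentials -/

namespace SumConstraints

variable {n m : ℕ} (I : SumConstraints n m)

lemma costOf_congr {t : Fin n} {x x' : Fin n → Bool} (h : ∀ j ≠ t, x j = x' j) (k : Fin m)
    (s : Bool) : I.costOf t x k s = I.costOf t x' k s := by
  rw [costOf_eq_sum, costOf_eq_sum]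
  refine Finset.sum_congr rfl fun S _ => ?_
  have : (∀ j ∈ controls t s S, x j = true) ↔ ∀ j ∈ controls t s S, x' j = true :=
    forall₂_congr fun j hj => by rw [h j fun hjt => notMem_controls t s S (hjt ▸ hj)]
  simp only [this]

lemma costOf_nonneg (t : Fin n) (x : Fin n → Bool) (k : Fin m) (s : Bool) :
    0 ≤ I.costOf t x k s := by
  rw [costOf_eq_sum]
  exact Finset.sum_nonneg fun S _ => by split_ifs <;> positivity

/-- The amount that the set `S` has been charged with: `|w_{S,k}| y_{S,k}` if it is closed. -/
def charge (t : ℕ) (x : Fin n → Bool) (k : Fin m) (S : Finset (Fin n)) : ℤ :=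
  if Closed t x S then |I.w S k| * I.yVar x S k else 0

lemma remaining_eq (t : ℕ) (x : Fin n → Bool) (k : Fin m) :
    I.remaining t x k = I.c k + I.shift k - ∑ S, I.charge t x k S := by
  simp only [remaining, charge, Finset.sum_filter]

lemma charge_nonneg (t : ℕ) (x : Fin n → Bool) (k : Fin m) (S) : 0 ≤ I.charge t x k S := by
  unfold charge yVar
  rw [prodVar_eq_ite]
  split_ifs <;> simp

lemma charge_le_abs (t : ℕ) (x : Fin n → Bool) (k : Fin m) (S) :
    I.charge t x k S ≤ |I.w S k| := by
  unfold charge yVar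
  rw [prodVar_eq_ite]
  split_ifs <;> simp

lemma charge_congr {t : ℕ} {x x' : Fin n → Bool} (h : ∀ j : Fin n, j.val < t → x j = x' j)
    (k : Fin m) (S : Finset (Fin n)) : I.charge t x k S = I.charge t x' k S := by
  have h1 : Closed t x S ↔ Closed t x' S := by
    unfold Closed
    refine or_congr_right (exists_congr fun j => and_congr_right fun _ => ?_)
    exact and_congr_right fun hj => by rw [h j hj]
  unfold charge
  by_cases hc : Closed t x S
  · rw [if_pos hc, if_pos (h1.1 hc)]
    have : prodVar x S = prodVar x' S := by
      rw [prodVar_eq_ite, prodVar_eq_ite]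
      rcases hc with hc | ⟨j, hj, hjt, hx⟩
      · have : (∀ j ∈ S, x j = true) ↔ ∀ j ∈ S, x' j = true :=
          forall₂_congr fun j hj => by rw [h j (hc j hj)]
        simp only [this]
      · rw [if_neg fun h' => by simp [h' j hj] at hx,
          if_neg fun h' => by simp [h j hjt, h' j hj] at hx]
    simp only [yVar, this]
  · rw [if_neg hc, if_neg fun h' => hc (h1.2 h')]

lemma remaining_congr {t : ℕ} {x x' : Fin n → Bool} (h : ∀ j : Fin n, j.val < t → x j = x' j)
    (k : Fin m) : I.remaining t x k = I.remaining t x' k := by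
  rw [remaining_eq, remaining_eq, Finset.sum_congr rfl fun S _ => I.charge_congr h k S]

lemma remaining_zero (hw : ∀ k, I.w ∅ k ≤ 0) (x : Fin n → Bool) (k : Fin m) :
    I.remaining 0 x k = I.c k + I.shift k := by
  rw [remaining_eq, Finset.sum_eq_zero, sub_zero]
  intro S _
  rcases S.eq_empty_or_nonempty with rfl | ⟨j, hj⟩
  · unfold charge yVar
    rcases (hw k).lt_or_eq with h | h
    · simp [prodVar, h.not_ge]
    · simp [h]
  · have : ¬ Closed 0 x S := by
      rintro (h | ⟨i, -, h, -⟩)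
      · exact absurd (h j hj) (by omega)
      · omega
    rw [charge, if_neg this]

/-- Assigning `x_t = 1` closes the sets with maximum `t` that have not met a zero. -/
lemma charge_succ_of_true (t : Fin n) {x : Fin n → Bool} (hx : x t = true) (k : Fin m)
    (S : Finset (Fin n)) : I.charge (t + 1) x k S = I.charge t x k S +
      if (t ∈ S ∧ ∀ j ∈ S, j ≤ t) ∧ 0 ≤ I.w S k then |I.w S k| * prodVar x (S.erase t) else 0 := by
  unfold charge
  by_cases h0 : Closed t x S
  · have h1 : Closed (t + 1) x S := h0.imp (fun h j hj => (h j hj).trans (by omega))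
      fun ⟨j, hj, hjt, hxj⟩ => ⟨j, hj, by omega, hxj⟩
    rw [if_pos h0, if_pos h1, left_eq_add, ite_eq_right_iff]
    rintro ⟨⟨htS, -⟩, -⟩
    rcases h0 with h0 | ⟨j, hj, hjt, hxj⟩
    · exact absurd (h0 t htS) (lt_irrefl _)
    · rw [prodVar_eq_ite, if_neg, mul_zero]
      intro h
      have := h j (Finset.mem_erase.2 ⟨fun h' => by simp [h'] at hjt, hj⟩)
      simp [this] at hxj
  · rw [if_neg h0]
    have htrue : ∀ j ∈ S, j.val < t → x j = true := fun j hj hjt => by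
      by_contra hxj
      exact h0 (Or.inr ⟨j, hj, hjt, by simpa using hxj⟩)
    by_cases h1 : Closed (t + 1) x S
    · have hle : ∀ j ∈ S, j ≤ t := by
        rcases h1 with h1 | ⟨j, hj, hjt, hxj⟩
        · exact fun j hj => Fin.le_def.2 (by have := h1 j hj; omega)
        · rcases Nat.lt_succ_iff_lt_or_eq.1 hjt with h | h
          · simp [htrue j hj h] at hxj
          · simp [Fin.ext h, hx] at hxj
      have htS : t ∈ S := by
        by_contra htS
        refine h0 (Or.inl fun j hj => ?_)
        have := Fin.le_def.1 (hle j hj)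
        exact lt_of_le_of_ne this fun h => htS (Fin.ext h ▸ hj)
      have hall : ∀ j ∈ S, x j = true := fun j hj => by
        rcases (Fin.le_def.1 (hle j hj)).lt_or_eq with h | h
        · exact htrue j hj h
        · rw [Fin.ext h, hx]
      rw [if_pos h1, yVar, prodVar_eq_ite, prodVar_eq_ite, if_pos hall,
        if_pos fun j hj => hall j (Finset.mem_of_mem_erase hj)]
      by_cases h : 0 ≤ I.w S k
      · rw [if_pos h, if_pos ⟨⟨htS, hle⟩, h⟩, zero_add]
      · rw [if_neg h, if_neg fun h' => h h'.2, sub_self, mul_zero, add_zero]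
    · rw [if_neg h1, if_neg, add_zero]
      rintro ⟨⟨-, hle⟩, -⟩
      exact h1 (Or.inl fun j hj => Nat.lt_succ_of_le (Fin.le_def.1 (hle j hj)))

/-- Assigning `x_t = 0` closes the sets containing `t` that have not met a zero. -/
lemma charge_succ_of_false (t : Fin n) {x : Fin n → Bool} (hx : x t = false) (k : Fin m)
    (S : Finset (Fin n)) : I.charge (t + 1) x k S = I.charge t x k S +
      if I.w S k < 0 ∧ t ∈ S then |I.w S k| * prodVar x {j ∈ S | j < t} else 0 := by
  unfold charge
  by_cases h0 : Closed t x S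
  · have h1 : Closed (t + 1) x S := h0.imp (fun h j hj => (h j hj).trans (by omega))
      fun ⟨j, hj, hjt, hxj⟩ => ⟨j, hj, by omega, hxj⟩
    rw [if_pos h0, if_pos h1, left_eq_add, ite_eq_right_iff]
    rintro ⟨-, htS⟩
    rcases h0 with h0 | ⟨j, hj, hjt, hxj⟩
    · exact absurd (h0 t htS) (lt_irrefl _)
    · rw [prodVar_eq_ite, if_neg, mul_zero]
      intro h
      have := h j (Finset.mem_filter.2 ⟨hj, Fin.lt_def.2 hjt⟩)
      simp [this] at hxj
  · rw [if_neg h0]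
    have htrue : ∀ j ∈ S, j.val < t → x j = true := fun j hj hjt => by
      by_contra hxj
      exact h0 (Or.inr ⟨j, hj, hjt, by simpa using hxj⟩)
    by_cases htS : t ∈ S
    · have h1 : Closed (t + 1) x S := Or.inr ⟨t, htS, by omega, hx⟩
      have hp : ∀ j ∈ ({j ∈ S | j < t} : Finset (Fin n)), x j = true := fun j hj =>
        htrue j (Finset.mem_filter.1 hj).1 (Fin.lt_def.1 (Finset.mem_filter.1 hj).2)
      have hS : prodVar x S = 0 := by
        rw [prodVar_eq_ite, if_neg fun h => by simp [h t htS] at hx]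
      rw [if_pos h1, yVar, hS, prodVar_eq_ite, if_pos hp]
      rcases lt_or_ge (I.w S k) 0 with h | h
      · rw [if_neg h.not_ge, if_pos ⟨h, htS⟩, sub_zero, zero_add]
      · rw [if_pos h, if_neg fun h' => h'.1.not_ge h, mul_zero, add_zero]
    · have h1 : ¬ Closed (t + 1) x S := by
        rintro (h1 | ⟨j, hj, hjt, hxj⟩)
        · refine h0 (Or.inl fun j hj => ?_)
          exact lt_of_le_of_ne (Nat.le_of_lt_succ (h1 j hj)) fun h => htS (Fin.ext h ▸ hj)
        · rcases Nat.lt_succ_iff_lt_or_eq.1 hjt with h | h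
          · simp [htrue j hj h] at hxj
          · exact htS (Fin.ext h ▸ hj)
      rw [if_neg h1, if_neg fun h => htS h.2, add_zero]

lemma remaining_succ (t : Fin n) (x : Fin n → Bool) (k : Fin m) :
    I.remaining (t + 1) x k = I.remaining t x k - I.cost t x k := by
  rw [remaining_eq, remaining_eq, cost]
  cases hx : x t
  · rw [Finset.sum_congr rfl fun S _ => I.charge_succ_of_false t hx k S, Finset.sum_add_distrib,
      ← Finset.sum_filter]
    simp only [Bool.false_eq_true, if_false, QMinus]
    ring
  · rw [Finset.sum_congr rfl fun S _ => I.charge_succ_of_true t hx k S, Finset.sum_add_distrib,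
      ← Finset.sum_filter]
    simp only [if_true, QPlus]
    ring

lemma remaining_le (t : ℕ) (x : Fin n → Bool) (k : Fin m) :
    I.remaining t x k ≤ I.c k + I.shift k := by
  rw [remaining_eq]
  have := Finset.sum_nonneg fun S (_ : S ∈ Finset.univ) => I.charge_nonneg t x k S
  omega

/-- The part of the charges that is due to non-negative coefficients. -/
def posCharge (t : ℕ) (x : Fin n → Bool) (k : Fin m) : ℤ :=
  ∑ S with 0 ≤ I.w S k, I.charge t x k S

/-- The charges that are due to negative coefficients lie between `0` and `P_k`. -/
lemma le_remaining (t : ℕ) (x : Fin n → Bool) (k : Fin m) :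
    I.c k - I.posCharge t x k ≤ I.remaining t x k ∧
      I.remaining t x k ≤ I.c k + I.shift k - I.posCharge t x k := by
  have h1 : ∑ S, I.charge t x k S = I.posCharge t x k + ∑ S with I.w S k < 0, I.charge t x k S := by
    rw [posCharge, ← Finset.sum_filter_add_sum_filter_not Finset.univ fun S => 0 ≤ I.w S k]
    simp only [not_le]
  have h2 : ∑ S with I.w S k < 0, I.charge t x k S ≤ I.shift k :=
    Finset.sum_le_sum fun S _ => I.charge_le_abs t x k S
  have h3 : 0 ≤ ∑ S with I.w S k < 0, I.charge t x k S :=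
    Finset.sum_nonneg fun S _ => I.charge_nonneg t x k S
  rw [remaining_eq]
  omega

lemma posCharge_zero (hw : ∀ k, I.w ∅ k ≤ 0) (x : Fin n → Bool) (k : Fin m) :
    I.posCharge 0 x k = 0 := by
  have h1 := I.remaining_zero hw x k
  have h2 := (I.le_remaining 0 x k).2
  have h3 : 0 ≤ I.posCharge 0 x k := Finset.sum_nonneg fun S _ => I.charge_nonneg 0 x k S
  omega

lemma posCharge_congr {t : ℕ} {x x' : Fin n → Bool} (h : ∀ j : Fin n, j.val < t → x j = x' j)
    (k : Fin m) : I.posCharge t x k = I.posCharge t x' k :=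
  Finset.sum_congr rfl fun S _ => I.charge_congr h k S

lemma posCharge_succ_of_false (t : Fin n) {x : Fin n → Bool} (hx : x t = false) (k : Fin m) :
    I.posCharge (t + 1) x k = I.posCharge t x k := by
  refine Finset.sum_congr rfl fun S hS => ?_
  rw [I.charge_succ_of_false t hx, if_neg fun h => ?_, add_zero]
  exact absurd h.1 (Finset.mem_filter.1 hS).2.not_gt

lemma PotentiallySatisfiable.of_succ {I : SumConstraints n m} {t : Fin n} {x : Fin n → Bool}
    (h : I.PotentiallySatisfiable (t + 1) x) : I.PotentiallySatisfiable t x := fun k => by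
  have h1 := h k
  have h2 := I.costOf_nonneg t x k (x t)
  rw [remaining_succ, cost_eq_costOf] at h1
  omega

lemma potentiallySatisfiable_congr {t : ℕ} {x x' : Fin n → Bool}
    (h : ∀ j : Fin n, j.val < t → x j = x' j) :
    I.PotentiallySatisfiable t x ↔ I.PotentiallySatisfiable t x' :=
  forall_congr' fun k => by rw [I.remaining_congr h]

lemma potentiallySatisfiable_iff_feasible (x : Fin n → Bool) :
    I.PotentiallySatisfiable n x ↔ I.Feasible x := by
  refine forall_congr' fun k => ?_
  have h1 : ∑ S, I.charge n x k S = ∑ S, I.w S k * prodVar x S + I.shift k := by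
    rw [shift, Finset.sum_filter, ← Finset.sum_add_distrib]
    refine Finset.sum_congr rfl fun S _ => ?_
    have hc : Closed n x S := Or.inl fun j _ => j.2
    rw [charge, if_pos hc, yVar]
    rcases lt_or_ge (I.w S k) 0 with h | h
    · rw [if_neg h.not_ge, if_pos h, abs_of_neg h]
      ring
    · rw [if_pos h, if_neg h.not_gt, abs_of_nonneg h, add_zero]
  rw [remaining_eq, h1]
  constructor <;> intro <;> omega

end SumConstraints

/-! ### The generated assignments -/

namespace SumConstraints

variable {n m κ : ℕ} (I : SumConstraints n m) {θ : Fin n → ℝ}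

/-- In a register state that holds the remaining potentials, `b⁺` and `b⁻` test the successors. -/
lemma costOf_le_iff {t : Fin n} {s : RegConfig n m κ}
    (hs : ∀ k, (s.2 k).toInt = I.remaining t s.1 k) (b : Bool) :
    (∀ k, I.costOf t s.1 k b ≤ (s.2 k).toInt) ↔
      I.PotentiallySatisfiable (t + 1) (update s.1 t b) := by
  refine forall_congr' fun k => ?_
  have hne : ∀ j : Fin n, j ≠ t → update s.1 t b j = s.1 j := fun j hj => update_of_ne hj _ _
  rw [remaining_succ, cost_eq_costOf, update_self, I.costOf_congr hne,
    I.remaining_congr fun j hj => hne j fun h => by simp [h] at hj, hs]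
  omega

lemma branchGate_ne_zero_iff {ϑ : ℝ} (hs : Real.sin (ϑ / 2) ≠ 0) (hc : Real.cos (ϑ / 2) ≠ 0)
    (t : Fin n) (s : RegConfig n m κ) (b : Bool) :
    I.branchGate ϑ t s b false ≠ 0 ↔
      (b = true ∧ I.bPlus t s) ∨ (b = false ∧ (I.bMinus t s ∨ ¬ I.bPlus t s)) := by
  have hs' : (Real.sin (ϑ / 2) : ℂ) ≠ 0 := by exact_mod_cast hs
  have hc' : (Real.cos (ϑ / 2) : ℂ) ≠ 0 := by exact_mod_cast hc
  unfold branchGate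
  by_cases hp : I.bPlus t s <;> by_cases hm : I.bMinus t s <;> cases b <;>
    simp only [hp, hm, and_true, and_false, not_true, not_false_eq_true, if_true, if_false,
      rotY, notX, Matrix.of_apply] <;> simp [hs', hc', -Complex.ofReal_sin, -Complex.ofReal_cos]

/-- What a basis state with non-zero amplitude after `t` steps satisfies. The bound on the charges
prevents overflow: a non-negative coefficient is charged for only while the potential stays
non-negative, and all the negative coefficients together are worth at most `P_k`. -/
def StateInvariant (κ : ℕ) (θ : Fin n → ℝ) (t : ℕ) : Prop :=
  ∀ (x : Fin n → Bool) (r : Fin m → BitVec κ), I.stateAfter κ θ t (x, r) ≠ 0 →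
    (∀ j : Fin n, t ≤ j.val → x j = false) ∧
    ∀ k, (r k).toInt = I.remaining t x k ∧ I.posCharge t x k ≤ max 0 (I.c k + I.shift k)

/-- As `x_t = 0` before step `t + 1`, each amplitude after it comes from a single basis state. -/
lemma stateAfter_succ_apply {t : Fin n} (ht : I.StateInvariant κ θ t) (x : Fin n → Bool)
    (r : Fin m → BitVec κ) :
    I.stateAfter κ θ (t + 1) (x, r) =
      I.branchGate (θ t) t (x, fun k => r k + BitVec.ofInt κ (I.cost t x k)) (x t) false *
        I.stateAfter κ θ t (update x t false, fun k => r k + BitVec.ofInt κ (I.cost t x k)) := by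
  have h1 : I.stateAfter κ θ t
      (update x t true, fun k => r k + BitVec.ofInt κ (I.cost t x k)) = 0 := by
    by_contra h
    have := (ht _ _ h).1 t le_rfl
    simp at this
  simp only [stateAfter, t.2, dif_pos, oracle, subtract, branch, Fintype.sum_bool, h1, mul_zero,
    zero_add]

variable {I}

lemma stateInvariant_succ (hκ : 1 ≤ κ) (hfit : I.FitsIn κ)
    (hθ : ∀ t, Real.sin (θ t / 2) ≠ 0 ∧ Real.cos (θ t / 2) ≠ 0) {t : Fin n}
    (ht : I.StateInvariant κ θ t) : I.StateInvariant κ θ (t + 1) := by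
  intro x r hxr
  rw [I.stateAfter_succ_apply ht] at hxr
  obtain ⟨hgate, hamp⟩ := mul_ne_zero_iff.1 hxr
  obtain ⟨hzero, hk⟩ := ht _ _ hamp
  have hlt : ∀ j : Fin n, j.val < t → update x t false j = x j := fun j hj =>
    update_of_ne (fun h => by simp [h] at hj) _ _
  have hrem : ∀ k, (r k + BitVec.ofInt κ (I.cost t x k)).toInt = I.remaining t x k := fun k => by
    rw [(hk k).1, I.remaining_congr hlt]
  refine ⟨fun j hj => ?_, fun k => ?_⟩
  · have hjt : j ≠ t := fun h => by simp [h] at hj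
    rw [← update_of_ne hjt false x]
    exact hzero j (by omega)
  · have hpos : I.posCharge (t + 1) x k ≤ max 0 (I.c k + I.shift k) := by
      cases hx : x t
      · rw [I.posCharge_succ_of_false t hx, ← I.posCharge_congr hlt]
        exact (hk k).2
      · rw [I.branchGate_ne_zero_iff (hθ t).1 (hθ t).2, hx] at hgate
        have hb : I.bPlus t (x, fun k => r k + BitVec.ofInt κ (I.cost t x k)) := by
          simpa using hgate
        have h1 := (I.costOf_le_iff hrem true).1 hb k
        simp only [← hx, update_eq_self] at h1
        have h2 := (I.le_remaining (t + 1) x k).2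
        omega
    refine ⟨?_, hpos⟩
    obtain ⟨f1, f2, f3⟩ := hfit k
    have h1 := (I.le_remaining (t + 1) x k).1
    have h2 := I.remaining_le (t + 1) x k
    have h3 : r k = BitVec.ofInt κ (I.remaining (t + 1) x k) := by
      rw [remaining_succ, ← hrem, sub_eq_add_neg, BitVec.ofInt_add, BitVec.ofInt_toInt,
        BitVec.ofInt_neg, ← BitVec.sub_eq_add_neg, BitVec.add_sub_cancel]
    rw [h3, BitVec.toInt_ofInt_eq_self (by omega) (by omega) (by omega)]

lemma stateInvariant (hκ : 1 ≤ κ) (hw : ∀ k, I.w ∅ k ≤ 0) (hfit : I.FitsIn κ)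
    (hθ : ∀ t, Real.sin (θ t / 2) ≠ 0 ∧ Real.cos (θ t / 2) ≠ 0) {t : ℕ} (htn : t ≤ n) :
    I.StateInvariant κ θ t := by
  induction t with
  | zero =>
    intro x r hxr
    have h1 : (x, r) = ((fun _ => false, fun k => BitVec.ofInt κ (I.c k + I.shift k)) :
        RegConfig n m κ) := by
      by_contra h
      exact hxr (Pi.single_eq_of_ne h _)
    obtain ⟨rfl, rfl⟩ := Prod.mk.inj h1
    refine ⟨fun _ _ => rfl, fun k => ⟨?_, ?_⟩⟩
    · obtain ⟨f1, f2, f3⟩ := hfit k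
      have h2 : 0 ≤ I.shift k := Finset.sum_nonneg fun S _ => abs_nonneg _
      rw [I.remaining_zero hw, BitVec.toInt_ofInt_eq_self (by omega) (by omega) (by omega)]
    · rw [I.posCharge_zero hw]
      exact le_max_left _ _
  | succ t ih => exact stateInvariant_succ hκ hfit hθ (t := ⟨t, htn⟩) (ih (by omega))

/-- An assignment generated after `t + 1` steps comes from the one in which `x_t` is still `0`. -/
lemma StateInvariant.generated_of_succ {t : Fin n} (ht : I.StateInvariant κ θ t)
    {x : Fin n → Bool} (hx : I.Generated κ θ (t + 1) x) :
    I.Generated κ θ t (update x t false) := by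
  obtain ⟨r, hr⟩ := hx
  rw [I.stateAfter_succ_apply ht] at hr
  exact ⟨_, right_ne_zero_of_mul hr⟩

/-- A successor is generated if and only if the gate on qubit `t` produces it. -/
lemma StateInvariant.generated_succ_iff
    (hθ : ∀ t, Real.sin (θ t / 2) ≠ 0 ∧ Real.cos (θ t / 2) ≠ 0) {t : Fin n}
    (ht : I.StateInvariant κ θ t) {x : Fin n → Bool} (hx : I.Generated κ θ t x) (b : Bool) :
    I.Generated κ θ (t + 1) (update x t b) ↔
      I.PotentiallySatisfiable (t + 1) (update x t b) ∨
        (b = false ∧ ∀ b', ¬ I.PotentiallySatisfiable (t + 1) (update x t b')) := by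
  obtain ⟨r, hr⟩ := hx
  obtain ⟨hzero, -⟩ := ht x r hr
  have hback : update (update x t b) t false = x := by
    rw [update_idem, ← hzero t le_rfl, update_eq_self]
  -- the gate is the same for all the register contents that can occur
  have hgate : ∀ r' : Fin m → BitVec κ, I.stateAfter κ θ t (x, r') ≠ 0 →
      (I.branchGate (θ t) t (update x t b, r') b false ≠ 0 ↔
        I.PotentiallySatisfiable (t + 1) (update x t b) ∨
          (b = false ∧ ∀ b', ¬ I.PotentiallySatisfiable (t + 1) (update x t b'))) := by
    intro r' hr'
    have hrem : ∀ k, (r' k).toInt = I.remaining t (update x t b) k := fun k => by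
      rw [((ht x r' hr').2 k).1]
      exact I.remaining_congr (fun j hj => (update_of_ne (fun h => by simp [h] at hj) _ _).symm) k
    have hp : I.bPlus t (update x t b, r') ↔
        I.PotentiallySatisfiable (t + 1) (update x t true) := by
      have h := I.costOf_le_iff (s := (update x t b, r')) hrem true
      simp only [update_idem] at h
      exact h
    have hm : I.bMinus t (update x t b, r') ↔
        I.PotentiallySatisfiable (t + 1) (update x t false) := by
      have h := I.costOf_le_iff (s := (update x t b, r')) hrem false
      simp only [update_idem] at h
      exact h
    rw [I.branchGate_ne_zero_iff (hθ t).1 (hθ t).2, hp, hm]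
    by_cases h1 : I.PotentiallySatisfiable (t + 1) (update x t true) <;>
      by_cases h0 : I.PotentiallySatisfiable (t + 1) (update x t false) <;>
      cases b <;> simp [h1, h0]
  constructor
  · rintro ⟨r', hr'⟩
    rw [I.stateAfter_succ_apply ht, hback, update_self] at hr'
    exact (hgate _ (right_ne_zero_of_mul hr')).1 (left_ne_zero_of_mul hr')
  · intro h
    refine ⟨fun k => r k - BitVec.ofInt κ (I.cost t (update x t b) k), ?_⟩
    rw [I.stateAfter_succ_apply ht, hback, update_self]
    simp only [BitVec.sub_add_cancel]
    exact mul_ne_zero ((hgate r hr).2 h) hr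

/-- Potential satisfiability is inherited by shorter assignments, so it holds along the whole
path. -/
lemma PotentiallySatisfiable.generated (hinv : ∀ t ≤ n, I.StateInvariant κ θ t)
    (hθ : ∀ t, Real.sin (θ t / 2) ≠ 0 ∧ Real.cos (θ t / 2) ≠ 0) {t : ℕ} (htn : t ≤ n)
    {x : Fin n → Bool} (hx : ∀ j : Fin n, t ≤ j.val → x j = false)
    (h : I.PotentiallySatisfiable t x) : I.Generated κ θ t x := by
  induction t generalizing x with
  | zero =>
    obtain rfl : x = fun _ => false := funext fun j => hx j (by omega)
    exact ⟨fun k => BitVec.ofInt κ (I.c k + I.shift k), by simp [stateAfter, initialState]⟩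
  | succ t ih =>
    set i : Fin n := ⟨t, htn⟩ with hi
    have hg : I.Generated κ θ t (update x i false) := by
      refine ih (by omega) (fun j hj => ?_) ?_
      · by_cases hj' : j = i
        · rw [hj', update_self]
        · rw [update_of_ne hj']
          refine hx j ?_
          have : j.val ≠ t := fun h => hj' (Fin.ext h)
          omega
      · refine (I.potentiallySatisfiable_congr fun j hj => ?_).2 (h.of_succ (t := i))
        exact update_of_ne (fun h => by simp [h, hi] at hj) _ _
    have h1 := ((hinv t (by omega)).generated_succ_iff (t := i) hθ hg (x i)).2
    rw [update_idem, update_eq_self] at h1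
    exact h1 (Or.inl h)

end SumConstraints

theorem mainTheorem1 :
    ∃ A : ℕ, ∀ p : Polynomial ℕ, ∃ p' : Polynomial ℕ,
      ∀ (n m κ : ℕ) (I : SumConstraints n m) (θ : Fin n → ℝ),
        1 ≤ m → 2 ≤ n * κ →
        (∀ k, I.w ∅ k ≤ 0) →
        (∀ k, (Finset.univ.filter fun S : Finset (Fin n) => I.w S k ≠ 0).card ≤ p.eval n) →
        I.FitsIn κ →
        (∀ t, Real.sin (θ t / 2) ≠ 0 ∧ Real.cos (θ t / 2) ≠ 0) →
        -- circuits for the oracles, with the depth of their concatenation and the qubit number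
        (∃ (a : ℕ) (circ : Fin n → QCircuit (RegQubit n m κ a)),
          (∀ t, Implements (circ t) (I.oracle (θ t) t)) ∧
          QCircuit.run (List.ofFn circ).flatten (withAncillas a (I.initialState κ)) =
            withAncillas a (I.stateAfter κ θ n) ∧
          ((List.ofFn circ).flatten.length : ℝ) ≤
            (p'.eval n : ℕ) * m * (Real.logb 2 n + Real.logb 2 κ) ∧
          Fintype.card (RegQubit n m κ a) ≤ A * (n + m * κ)) ∧
        -- the registers hold the remaining potentials of the generated partial assignments
        (∀ t ≤ n, ∀ x r, I.stateAfter κ θ t (x, r) ≠ 0 →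
          (∀ j : Fin n, t ≤ j.val → x j = false) ∧ ∀ k, (r k).toInt = I.remaining t x k) ∧
        -- every potentially satisfiable partial assignment is generated
        (∀ t ≤ n, ∀ x : Fin n → Bool, (∀ j : Fin n, t ≤ j.val → x j = false) →
          I.PotentiallySatisfiable t x → I.Generated κ θ t x) ∧
        -- the successors that one step generates
        (∀ (t : Fin n) (x : Fin n → Bool), I.Generated κ θ t x → ∀ b : Bool,
          (I.Generated κ θ (t + 1) (Function.update x t b) ↔
            I.PotentiallySatisfiable (t + 1) (Function.update x t b) ∨
            (b = false ∧ ∀ b' : Bool,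
              ¬ I.PotentiallySatisfiable (t + 1) (Function.update x t b')))) ∧
        -- every assignment that one step generates is such a successor
        (∀ (t : Fin n) (x : Fin n → Bool), I.Generated κ θ (t + 1) x →
          I.Generated κ θ t (Function.update x t false)) ∧
        -- an infeasible branch is new only where neither successor is potentially satisfiable
        (∀ (t : Fin n) (x : Fin n → Bool), I.Generated κ θ (t + 1) x →
          I.PotentiallySatisfiable t x → ¬ I.PotentiallySatisfiable (t + 1) x →
          ∀ b : Bool, ¬ I.PotentiallySatisfiable (t + 1) (Function.update x t b)) ∧
        -- at the end, potentially satisfiable means feasible, and all feasible solutions occur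
        (∀ x : Fin n → Bool, I.PotentiallySatisfiable n x ↔ I.Feasible x) ∧
        (∀ x : Fin n → Bool, I.Feasible x → I.Generated κ θ n x) := by
  refine ⟨45, fun p => ⟨Polynomial.C 1690 * Polynomial.X * (p + 1) * (Polynomial.X + 2), ?_⟩⟩
  intro n m κ I θ hm hnκ hw hp hfit hθ
  have hκ : 1 ≤ κ := Nat.pos_of_ne_zero (by rintro rfl; simp at hnκ)
  have hinv : ∀ t ≤ n, I.StateInvariant κ θ t := fun t ht =>
    SumConstraints.stateInvariant hκ hw hfit hθ ht
  have hgen : ∀ t ≤ n, ∀ x : Fin n → Bool, (∀ j : Fin n, t ≤ j.val → x j = false) →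
      I.PotentiallySatisfiable t x → I.Generated κ θ t x := fun t ht x hx h =>
    h.generated hinv hθ ht hx
  have hback : ∀ (t : Fin n) (x : Fin n → Bool), I.Generated κ θ (t + 1) x →
      I.Generated κ θ t (Function.update x t false) := fun t x hx =>
    (hinv t t.2.le).generated_of_succ hx
  have hsucc : ∀ (t : Fin n) (x : Fin n → Bool), I.Generated κ θ t x → ∀ b : Bool,
      (I.Generated κ θ (t + 1) (Function.update x t b) ↔
        I.PotentiallySatisfiable (t + 1) (Function.update x t b) ∨
        (b = false ∧ ∀ b' : Bool,
          ¬ I.PotentiallySatisfiable (t + 1) (Function.update x t b'))) := fun t x hx b =>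
    (hinv t t.2.le).generated_succ_iff hθ hx b
  refine ⟨exists_circuits I p θ hm hnκ hp, fun t ht x r hr => ?_, hgen, hsucc, hback, ?_,
    I.potentiallySatisfiable_iff_feasible, fun x hx => ?_⟩
  · exact ⟨(hinv t ht x r hr).1, fun k => ((hinv t ht x r hr).2 k).1⟩
  · intro t x hx _ hnot b
    have h := hsucc t _ (hback t x hx) (x t)
    rw [Function.update_idem, Function.update_eq_self] at h
    have h1 := ((h.1 hx).resolve_left hnot).2 b
    rwa [Function.update_idem] at h1
  · exact hgen n le_rfl x (fun j hj => absurd j.2 (by omega))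
      ((I.potentiallySatisfiable_iff_feasible x).2 hx)
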